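/- All $C^*$-algebras are over $\mathbb{C}$, and $\otimes$ denotes the minimal (spatial) tensor product of $C^*$-algebras. For a unital $C^*$-algebra $B$ let $\mathcal{U}(B)$ be its unitary group with the norm topology and $\mathcal{U}_0(B)$ the connected component of $1_B$ in $\mathcal{U}(B)$. Two $*$-homomorphisms $\sigma,\gamma: C\to B$ into a unital $C^*$-algebra $B$ are *approximately unitarily equivalent* if there is a sequence $(u_n)_{n\in\mathbb{N}}$ in $\mathcal{U}(B)$ with $\lim_{n\to\infty}\|u_n\sigma(c)u_n^*-\gamma(c)\|=0$ for every $c\in C$. They are *strongly asymptotically unitarily equivalent* if there is a norm-continuous path $(u_t)_{t\in[0,\infty)}$ in $\mathcal{U}(B)$ with $u_0=1_B$ and $\lim_{t\to\infty}\|u_t\sigma(c)u_t^*-\gamma(c)\|=0$ for every $c\in C$. A separable unital $C^*$-algebra $D\not\cong\mathbb{C}$ is *strongly self-absorbing* if there is a $*$-isomorphism $\varphi: D\to D\otimes D$ which is approximately unitarily equivalent to $d\mapsto d\otimes 1_D$. A unital $C^*$-algebra $D$ is *$K_1$-injective* if the canonical map $\mathcal{U}(D)/\mathcal{U}_0(D)\to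 K_1(D)$ is injective, where $K_1(D)=\varinjlim_n \mathcal{U}(M_n(D))/\mathcal{U}_0(M_n(D))$ along the maps $u\mapsto u\oplus 1$. **Theorem 1.2.** Let $A$ and $D$ be unital $C^*$-algebras, with $D$ separable, strongly self-absorbing and $K_1$-injective. Then any two unital $*$-homomorphisms $\sigma,\gamma: D\to A\otimes D$ are strongly asymptotically unitarily equivalent. In particular, any two unital $*$-endomorphisms of $D$ are strongly asymptotically unitarily equivalent. -/

import Mathlib

open scoped TensorProduct InnerProductSpace ComplexOrder Topology

/-! ### Amplifications on the Hilbert space tensor product -/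

section Amplification

variable (H K : Type*) [NormedAddCommGroup H] [InnerProductSpace ℂ H]
  [NormedAddCommGroup K] [InnerProductSpace ℂ K]

/-- The Hilbert space tensor product of `H` and `K`: the completion of the algebraic tensor
product for the inner product `⟪x ⊗ y, x' ⊗ y'⟫ = ⟪x, x'⟫ * ⟪y, y'⟫`. -/
def HilbertTensor := UniformSpace.Completion (H ⊗[ℂ] K)

noncomputable instance : NormedAddCommGroup (HilbertTensor H K) :=
  inferInstanceAs (NormedAddCommGroup (UniformSpace.Completion (H ⊗[ℂ] K)))

noncomputable instance : InnerProductSpace ℂ (HilbertTensor H K) :=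
  inferInstanceAs (InnerProductSpace ℂ (UniformSpace.Completion (H ⊗[ℂ] K)))

instance : CompleteSpace (HilbertTensor H K) :=
  inferInstanceAs (CompleteSpace (UniformSpace.Completion (H ⊗[ℂ] K)))

/-- The inclusion of the algebraic tensor product. -/
noncomputable def toHilbertTensor : (H ⊗[ℂ] K) →ₗᵢ[ℂ] HilbertTensor H K :=
  UniformSpace.Completion.toComplₗᵢ (𝕜 := ℂ) (E := H ⊗[ℂ] K)

theorem denseRange_toHilbertTensor : DenseRange (toHilbertTensor H K) :=
  UniformSpace.Completion.denseRange_coe (α := H ⊗[ℂ] K)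

variable {H K}

/-- The bounded operator `S ⊗ T` on the Hilbert space tensor product. -/
noncomputable def opTensor (S : H →L[ℂ] H) (T : K →L[ℂ] K) :
    HilbertTensor H K →L[ℂ] HilbertTensor H K :=
  (TensorProduct.mapL S T).completion

theorem opTensor_apply (S : H →L[ℂ] H) (T : K →L[ℂ] K) (x : H ⊗[ℂ] K) :
    opTensor S T (toHilbertTensor H K x) =
      toHilbertTensor H K (TensorProduct.map S.toLinearMap T.toLinearMap x) := by
  have h := (TensorProduct.mapL S T).completion_apply_coe x
  rw [TensorProduct.mapL_apply] at h
  exact h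

theorem hilbertTensor_ext {S T : HilbertTensor H K →L[ℂ] HilbertTensor H K}
    (h : ∀ x, S (toHilbertTensor H K x) = T (toHilbertTensor H K x)) : S = T :=
  DFunLike.coe_injective
    ((denseRange_toHilbertTensor H K).equalizer S.continuous T.continuous (funext h))

theorem opTensor_mul (S S' : H →L[ℂ] H) (T T' : K →L[ℂ] K) :
    opTensor (S * S') (T * T') = opTensor S T * opTensor S' T' := by
  refine hilbertTensor_ext fun x => ?_
  rw [mul_apply_eq_comp, opTensor_apply, opTensor_apply, opTensor_apply,
    ← LinearMap.comp_apply, ← TensorProduct.map_comp]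
  rfl

theorem opTensor_one : opTensor (1 : H →L[ℂ] H) (1 : K →L[ℂ] K) = 1 := by
  refine hilbertTensor_ext fun x => ?_
  rw [opTensor_apply]
  change toHilbertTensor H K (TensorProduct.map LinearMap.id LinearMap.id x) = _
  simp

theorem opTensor_add_left (S S' : H →L[ℂ] H) (T : K →L[ℂ] K) :
    opTensor (S + S') T = opTensor S T + opTensor S' T := by
  refine hilbertTensor_ext fun x => ?_
  simp [opTensor_apply, TensorProduct.map_add_left]

theorem opTensor_add_right (S : H →L[ℂ] H) (T T' : K →L[ℂ] K) :
    opTensor S (T + T') = opTensor S T + opTensor S T' := by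
  refine hilbertTensor_ext fun x => ?_
  simp [opTensor_apply, TensorProduct.map_add_right]

theorem opTensor_smul_left (c : ℂ) (S : H →L[ℂ] H) (T : K →L[ℂ] K) :
    opTensor (c • S) T = c • opTensor S T := by
  refine hilbertTensor_ext fun x => ?_
  simp [opTensor_apply, TensorProduct.map_smul_left]

theorem opTensor_smul_right (c : ℂ) (S : H →L[ℂ] H) (T : K →L[ℂ] K) :
    opTensor S (c • T) = c • opTensor S T := by
  refine hilbertTensor_ext fun x => ?_
  simp [opTensor_apply, TensorProduct.map_smul_right]

theorem opTensor_star [CompleteSpace H] [CompleteSpace K] (S : H →L[ℂ] H) (T : K →L[ℂ] K) :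
    opTensor (star S) (star T) = star (opTensor S T) := by
  refine (ContinuousLinearMap.eq_adjoint_iff _ _).mpr fun x y => ?_
  refine (denseRange_toHilbertTensor H K).induction_on₂
    (p := fun x y => ⟪opTensor (star S) (star T) x, y⟫_ℂ = ⟪x, opTensor S T y⟫_ℂ)
    (isClosed_eq (by fun_prop) (by fun_prop)) (fun x y => ?_) x y
  rw [opTensor_apply, opTensor_apply, LinearIsometry.inner_map_map, LinearIsometry.inner_map_map]
  induction x with
  | zero => simp
  | add x x' hx hx' => simp only [map_add, inner_add_left, hx, hx']
  | tmul a b =>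
    induction y with
    | zero => simp
    | add y y' hy hy' => simp only [map_add, inner_add_right, hy, hy']
    | tmul c d =>
      simp [ContinuousLinearMap.star_eq_adjoint, ContinuousLinearMap.adjoint_inner_left]

variable (H K) [CompleteSpace H] [CompleteSpace K]

/-- The amplification `S ↦ S ⊗ 1`. -/
noncomputable def ampLeft :
    (H →L[ℂ] H) →⋆ₐ[ℂ] (HilbertTensor H K →L[ℂ] HilbertTensor H K) where
  toFun S := opTensor S (1 : K →L[ℂ] K)
  map_one' := opTensor_one
  map_mul' S S' := by rw [← opTensor_mul, one_mul]
  map_zero' := by simpa using opTensor_smul_left 0 (0 : H →L[ℂ] H) (1 : K →L[ℂ] K)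
  map_add' S S' := opTensor_add_left S S' 1
  commutes' c := by
    rw [Algebra.algebraMap_eq_smul_one, Algebra.algebraMap_eq_smul_one, opTensor_smul_left,
      opTensor_one]
  map_star' S := by rw [← opTensor_star, star_one]

/-- The amplification `T ↦ 1 ⊗ T`. -/
noncomputable def ampRight :
    (K →L[ℂ] K) →⋆ₐ[ℂ] (HilbertTensor H K →L[ℂ] HilbertTensor H K) where
  toFun T := opTensor (1 : H →L[ℂ] H) T
  map_one' := opTensor_one
  map_mul' T T' := by rw [← opTensor_mul, one_mul]
  map_zero' := by simpa using opTensor_smul_right 0 (1 : H →L[ℂ] H) (0 : K →L[ℂ] K)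
  map_add' T T' := opTensor_add_right 1 T T'
  commutes' c := by
    rw [Algebra.algebraMap_eq_smul_one, Algebra.algebraMap_eq_smul_one, opTensor_smul_right,
      opTensor_one]
  map_star' T := by rw [← opTensor_star, star_one]

end Amplification

/-! ### The universal representation of a unital C*-algebra -/

section UniversalRep

/-- The positive linear functionals on `A`. -/
abbrev PosFunctional (A : Type*) [CStarAlgebra A] : Type _ :=
  letI := CStarAlgebra.spectralOrder A
  A →ₚ[ℂ] ℂ

variable {A : Type*} [CStarAlgebra A]

/-- The GNS Hilbert space of a positive linear functional. -/
def GNSSpace (f : PosFunctional A) : Type _ :=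
  letI := CStarAlgebra.spectralOrder A
  letI := CStarAlgebra.spectralOrderedRing A
  PositiveLinearMap.GNS f

noncomputable instance (f : PosFunctional A) : NormedAddCommGroup (GNSSpace f) :=
  letI := CStarAlgebra.spectralOrder A
  letI := CStarAlgebra.spectralOrderedRing A
  inferInstanceAs (NormedAddCommGroup (PositiveLinearMap.GNS f))

noncomputable instance (f : PosFunctional A) : InnerProductSpace ℂ (GNSSpace f) :=
  letI := CStarAlgebra.spectralOrder A
  letI := CStarAlgebra.spectralOrderedRing A
  inferInstanceAs (InnerProductSpace ℂ (PositiveLinearMap.GNS f))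

instance (f : PosFunctional A) : CompleteSpace (GNSSpace f) :=
  letI := CStarAlgebra.spectralOrder A
  letI := CStarAlgebra.spectralOrderedRing A
  inferInstanceAs (CompleteSpace (PositiveLinearMap.GNS f))

/-- The GNS representation of a positive linear functional. -/
noncomputable def gnsRep (f : PosFunctional A) : A →⋆ₐ[ℂ] (GNSSpace f →L[ℂ] GNSSpace f) :=
  letI := CStarAlgebra.spectralOrder A
  letI := CStarAlgebra.spectralOrderedRing A
  PositiveLinearMap.gnsStarAlgHom f

theorem norm_gnsRep_le (f : PosFunctional A) (a : A) : ‖gnsRep f a‖ ≤ ‖a‖ :=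
  NonUnitalStarAlgHom.norm_apply_le (gnsRep f) a

variable (A)

/-- The Hilbert space of the universal representation: the Hilbert sum of the GNS spaces of all
positive linear functionals. -/
abbrev UniversalSpace : Type _ := lp (fun f : PosFunctional A => GNSSpace f) 2

/-- The universal representation of `A`: the direct sum of all GNS representations. -/
noncomputable def universalRep : A →⋆ₐ[ℂ] (UniversalSpace A →L[ℂ] UniversalSpace A) where
  toFun a := lp.mapCLM 2 (fun f : PosFunctional A => gnsRep f a) (norm_nonneg a)
    (fun f => norm_gnsRep_le f a)
  map_one' := by ext x f; simp
  map_mul' a b := by ext x f; simp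
  map_zero' := by ext x f; simp
  map_add' a b := by ext x f; simp
  commutes' c := by ext x f; simp [Algebra.algebraMap_eq_smul_one]
  map_star' a := by
    refine (ContinuousLinearMap.eq_adjoint_iff _ _).mpr fun x y => ?_
    rw [lp.inner_eq_tsum, lp.inner_eq_tsum]
    refine tsum_congr fun f => ?_
    simp [map_star, ContinuousLinearMap.star_eq_adjoint, ContinuousLinearMap.adjoint_inner_left]

end UniversalRep

/-! ### The (minimal) C*-tensor product -/

section Tensor

/-- The spatial tensor product of two represented C*-algebras: the norm closure of the
*-algebra generated by all operators `π a ⊗ 1` and `1 ⊗ ρ b`, that is, of the linear span of all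
operators `π a ⊗ ρ b`. -/
noncomputable def spatialTensor {A B H K : Type*} [CStarAlgebra A] [CStarAlgebra B]
    [NormedAddCommGroup H] [InnerProductSpace ℂ H] [CompleteSpace H]
    [NormedAddCommGroup K] [InnerProductSpace ℂ K] [CompleteSpace K]
    (π : A →⋆ₐ[ℂ] (H →L[ℂ] H)) (ρ : B →⋆ₐ[ℂ] (K →L[ℂ] K)) :
    StarSubalgebra ℂ (HilbertTensor H K →L[ℂ] HilbertTensor H K) :=
  (((ampLeft H K).comp π).range ⊔ ((ampRight H K).comp ρ).range).topologicalClosure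

theorem isClosed_spatialTensor {A B H K : Type*} [CStarAlgebra A] [CStarAlgebra B]
    [NormedAddCommGroup H] [InnerProductSpace ℂ H] [CompleteSpace H]
    [NormedAddCommGroup K] [InnerProductSpace ℂ K] [CompleteSpace K]
    (π : A →⋆ₐ[ℂ] (H →L[ℂ] H)) (ρ : B →⋆ₐ[ℂ] (K →L[ℂ] K)) :
    IsClosed (spatialTensor π ρ : Set (HilbertTensor H K →L[ℂ] HilbertTensor H K)) :=
  StarSubalgebra.isClosed_topologicalClosure _

/-- The minimal (spatial) tensor product of the unital C*-algebras `A` and `B`, realized in the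
tensor product of their (faithful) universal representations. -/
def CStarTensor (A B : Type*) [CStarAlgebra A] [CStarAlgebra B] : Type _ :=
  spatialTensor (universalRep A) (universalRep B)

noncomputable instance (A B : Type*) [CStarAlgebra A] [CStarAlgebra B] :
    CStarAlgebra (CStarTensor A B) :=
  haveI := isClosed_spatialTensor (universalRep A) (universalRep B)
  inferInstanceAs (CStarAlgebra (spatialTensor (universalRep A) (universalRep B)))

/-- The first-factor embedding `a ↦ a ⊗ 1`. -/
noncomputable def tensorOneRight (A B : Type*) [CStarAlgebra A] [CStarAlgebra B] :
    A →⋆ₐ[ℂ] CStarTensor A B :=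
  ((ampLeft _ _).comp (universalRep A)).codRestrict
    (spatialTensor (universalRep A) (universalRep B)) fun a =>
      StarSubalgebra.le_topologicalClosure _ (le_sup_left (a := StarAlgHom.range _) ⟨a, rfl⟩)

end Tensor

/-! ### Unitary equivalence of *-homomorphisms -/

section Equivalence

variable {A B : Type*} [CStarAlgebra A] [CStarAlgebra B]

/-- Approximate unitary equivalence, implemented by a sequence of unitaries. -/
def ApproxUnitarilyEquiv (σ γ : A →⋆ₐ[ℂ] B) : Prop :=
  ∃ u : ℕ → unitary B, ∀ a : A,
    Filter.Tendsto (fun n => ‖(u n : B) * σ a * star (u n : B) - γ a‖) Filter.atTop (𝓝 0)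

/-- Strong asymptotic unitary equivalence: there is a norm-continuous path of unitaries, indexed
by `[0, ∞)` and starting at `1`, which intertwines the two maps asymptotically. -/
def StronglyAsympUnitarilyEquiv (σ γ : A →⋆ₐ[ℂ] B) : Prop :=
  ∃ u : NNReal → unitary B, Continuous u ∧ u 0 = 1 ∧ ∀ a : A,
    Filter.Tendsto (fun t => ‖(u t : B) * σ a * star (u t : B) - γ a‖) Filter.atTop (𝓝 0)

end Equivalence

/-- Strongly self-absorbing C*-algebras: `D` is separable, not isomorphic to `ℂ`, and there is an
isomorphism `D ≅ D ⊗ D` which is approximately unitarily equivalent to `d ↦ d ⊗ 1`. -/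
structure IsStronglySelfAbsorbing (D : Type*) [CStarAlgebra D] : Prop where
  separable : TopologicalSpace.SeparableSpace D
  ne_complex : IsEmpty (D ≃⋆ₐ[ℂ] ℂ)
  exists_equiv : ∃ φ : D ≃⋆ₐ[ℂ] CStarTensor D D,
    ApproxUnitarilyEquiv (φ : D →⋆ₐ[ℂ] CStarTensor D D) (tensorOneRight D D)

/-! ### The group `K₁` -/

section KOne

/-- The quotient `G / G₀` of a topological group by the connected component of the identity. -/
abbrev Pi0 (G : Type*) [Group G] [TopologicalSpace G] [IsTopologicalGroup G] : Type _ :=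
  G ⧸ Subgroup.connectedComponentOfOne G

instance (G : Type*) [Group G] [TopologicalSpace G] [IsTopologicalGroup G] :
    (Subgroup.connectedComponentOfOne G).Normal where
  conj_mem n hn g := by
    have hc : Continuous fun x : G => g * x * g⁻¹ := by fun_prop
    have h := hc.image_connectedComponent_subset 1 ⟨n, hn, rfl⟩
    rw [mul_one, mul_inv_cancel] at h
    exact h

/-- The map `G / G₀ → G' / G'₀` induced by a continuous homomorphism. -/
def Pi0.map {G G' : Type*} [Group G] [TopologicalSpace G] [IsTopologicalGroup G]
    [Group G'] [TopologicalSpace G'] [IsTopologicalGroup G'] (f : G →* G') (hf : Continuous f) :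
    Pi0 G →* Pi0 G' :=
  QuotientGroup.map _ _ f fun x hx => by
    have h := hf.image_connectedComponent_subset 1 ⟨x, hx, rfl⟩
    rw [map_one] at h
    exact h

variable (A : Type*) [CStarAlgebra A]

/-- The unitary group of `M_n(A)`. Its topology is that of entrywise convergence, which is the
topology of the C*-norm of `M_n(A)`. -/
abbrev UnitaryMat (n : ℕ) : Type _ := unitary (Matrix (Fin n) (Fin n) A)

variable {A}

/-- The matrix `a ⊕ 1` of size `m` for a matrix `a` of size `n ≤ m`. -/
def padMat {n : ℕ} (m : ℕ) (a : Matrix (Fin n) (Fin n) A) : Matrix (Fin m) (Fin m) A :=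
  fun i j => if h : (i : ℕ) < n ∧ (j : ℕ) < n then a ⟨i, h.1⟩ ⟨j, h.2⟩ else if i = j then 1 else 0

theorem padMat_one (n m : ℕ) : padMat m (1 : Matrix (Fin n) (Fin n) A) = 1 := by
  ext i j
  simp only [padMat, Matrix.one_apply, Fin.ext_iff]
  split_ifs <;> simp_all

theorem padMat_mul {n m : ℕ} (h : n ≤ m) (a b : Matrix (Fin n) (Fin n) A) :
    padMat m (a * b) = padMat m a * padMat m b := by
  obtain ⟨k, rfl⟩ := Nat.exists_eq_add_of_le h
  have e (i : Fin n) (j : Fin k) : Fin.castAdd k i ≠ Fin.natAdd n j := by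
    rw [Ne, Fin.ext_iff, Fin.val_castAdd, Fin.val_natAdd]
    omega
  ext i j
  rw [Matrix.mul_apply, Fin.sum_univ_add]
  refine Fin.addCases (fun i => ?_) (fun i => ?_) i <;>
    refine Fin.addCases (fun j => ?_) (fun j => ?_) j <;>
    simp [padMat, Matrix.mul_apply, e, (e _ _).symm]

theorem padMat_star {n : ℕ} (m : ℕ) (a : Matrix (Fin n) (Fin n) A) :
    padMat m (star a) = star (padMat m a) := by
  ext i j
  simp only [padMat, Matrix.star_apply]
  by_cases h : (i : ℕ) < n ∧ (j : ℕ) < n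
  · rw [dif_pos h, dif_pos h.symm]
  · rw [dif_neg h, dif_neg fun h' => h h'.symm]
    by_cases hij : i = j <;> simp [hij, Ne.symm]

theorem padMat_self {n : ℕ} (a : Matrix (Fin n) (Fin n) A) : padMat n a = a := by
  ext i j
  simp [padMat]

theorem padMat_padMat {n m k : ℕ} (h : n ≤ m) (a : Matrix (Fin n) (Fin n) A) :
    padMat k (padMat m a) = padMat k a := by
  ext i j
  simp only [padMat, Fin.ext_iff]
  split_ifs <;> first | rfl | omega

theorem continuous_padMat (n m : ℕ) :
    Continuous (padMat m : Matrix (Fin n) (Fin n) A → Matrix (Fin m) (Fin m) A) := by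
  refine continuous_matrix fun i j => ?_
  unfold padMat
  split_ifs <;> fun_prop

variable (A)

/-- The inclusion `U_n(A) → U_m(A)`, `u ↦ u ⊕ 1`, for `n ≤ m`. -/
def padUnitary {n m : ℕ} (h : n ≤ m) : UnitaryMat A n →* UnitaryMat A m where
  toFun u := ⟨padMat m u.1, by
    rw [Unitary.mem_iff, ← padMat_star, ← padMat_mul h, ← padMat_mul h,
      Unitary.star_mul_self_of_mem u.2, Unitary.mul_star_self_of_mem u.2, padMat_one]
    exact ⟨rfl, rfl⟩⟩
  map_one' := Subtype.ext (padMat_one n m)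
  map_mul' u v := Subtype.ext (padMat_mul h u.1 v.1)

theorem continuous_padUnitary {n m : ℕ} (h : n ≤ m) : Continuous (padUnitary A h) :=
  ((continuous_padMat n m).comp continuous_subtype_val).subtype_mk _

/-- The connecting maps `U_n(A) / U_n(A)₀ → U_m(A) / U_m(A)₀`. -/
def kOneMap (n m : ℕ) (h : n ≤ m) : Pi0 (UnitaryMat A n) →* Pi0 (UnitaryMat A m) :=
  Pi0.map (padUnitary A h) (continuous_padUnitary A h)

instance : DirectedSystem (fun n => Pi0 (UnitaryMat A n)) (kOneMap A · · ·) where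
  map_self n x := by
    induction x using QuotientGroup.induction_on with
    | H u => exact congrArg _ (Subtype.ext (padMat_self u.1))
  map_map n m k h h' x := by
    induction x using QuotientGroup.induction_on with
    | H u => exact congrArg _ (Subtype.ext (padMat_padMat h u.1))

/-- The group `K₁(A)` of a unital C*-algebra: the direct limit over `n` of the groups
`U_n(A) / U_n(A)₀` along the maps `u ↦ u ⊕ 1`. -/
abbrev KOne : Type _ := DirectLimit (fun n => Pi0 (UnitaryMat A n)) (kOneMap A)

/-- The identification of a unitary of `A` with a unitary `1 × 1` matrix. -/
def unitaryToMat : unitary A →* UnitaryMat A 1 where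
  toFun u := ⟨Matrix.of fun _ _ => (u : A), by
    constructor <;> ext i j <;> simp [Matrix.mul_apply, Matrix.one_apply, Subsingleton.elim i j]⟩
  map_one' := Subtype.ext (by ext i j; simp [Subsingleton.elim i j])
  map_mul' u v := Subtype.ext (by ext i j; simp [Matrix.mul_apply])

theorem continuous_unitaryToMat : Continuous (unitaryToMat A) := by
  exact Continuous.subtype_mk (continuous_matrix fun _ _ => continuous_subtype_val) _

/-- The canonical map `U(A) / U₀(A) → K₁(A)`. -/
def toKOne (x : Pi0 (unitary A)) : KOne A :=
  ⟦⟨1, Pi0.map (unitaryToMat A) (continuous_unitaryToMat A) x⟩⟧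

/-- `A` is `K₁`-injective if the canonical map `U(A) / U₀(A) → K₁(A)` is injective. -/
def IsKOneInjective : Prop := Function.Injective (toKOne A)

end KOne

/-!
# Strong asymptotic unitary equivalence of homomorphisms into `A ⊗ D`

Two facts about a strongly self-absorbing, `K₁`-injective algebra `D` carry the proof.

*The half flip is approximately inner by unitaries in the connected component of `1`*
(`IsStronglySelfAbsorbing.exists_joined_halfFlip`). That it is approximately inner follows from
functoriality of `⊗` and the isomorphism `D ≅ D ⊗ D`. With three tensor factors, a commutator
`s v s* v*` of unitaries, where `v` moves the third factor to the first and `s` the first to the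
second, moves the first factor to the second. Commutators are trivial in `K₁`, hence lie in the
connected component of `1` by `K₁`-injectivity (`IsKOneInjective.joined_commutator`).

*`B = A ⊗ D` and `B = D` absorb `D` approximately* (`ApproxAbsorbs`): there are homomorphisms
`B ⊗ D → B` close to the identity on `B ⊗ 1`. So next to any `σ : D → B` there is, up to a small
perturbation, another copy of `D` such that both generate a quotient of `D ⊗ D`, and `σ(D)` can be
flipped to it by a path of unitaries of `B` starting at `1`.

Flipping `σ(D)` and `γ(D)` to the same copy shows that `σ` and `γ` are approximately equivalent by
unitaries `v n` in the connected component of `1` (`exists_joined_conj_close`). The unitaries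
`(v n)* v (n + 1)` almost commute with `σ(D)`, and they are joined to `1` by paths with the same
property (`exists_joinedIn_almost_commuting`): conjugate any path from `1`, which commutes with the
second factor of `B ⊗ D`, by the flip of `σ(D)` into that factor. Concatenating these paths gives
the required family.

For the minimal tensor product this uses functoriality, the flip and the associator. Here an
operator on one Hilbert space dominates an operator on another as soon as a total family of bounded
maps intertwines them along with their adjoints (`Intertwines.norm_le`); GNS representations supply
such maps from the universal representation to any other. The associator also needs that `A ⊗ C`
is faithfully represented when `C` acts by any faithful representation instead of the universal one
(`CStarTensor.injective_of_faithful`).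
-/

/-! ### Operators intertwined by a total family of maps -/

section Intertwining

variable {X Y : Type*} [NormedAddCommGroup X] [InnerProductSpace ℂ X]
  [NormedAddCommGroup Y] [InnerProductSpace ℂ Y]

/-- The norms `‖T ^ n y‖` are log-convex in `n`, so exponential growth of rate `N` on a dense set
bounds the norm of a self-adjoint operator. -/
theorem IsSelfAdjoint.norm_le_of_growth [CompleteSpace Y] {T : Y →L[ℂ] Y} (hT : IsSelfAdjoint T)
    {N : ℝ} (hN : 0 ≤ N) {s : Set Y} (hs : Dense s)
    (h : ∀ y ∈ s, ∃ C : ℝ, ∀ n : ℕ, ‖(T ^ n) y‖ ≤ C * N ^ n) : ‖T‖ ≤ N := by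
  refine T.opNorm_le_bound hN fun y => ?_
  refine hs.induction (P := fun y => ‖T y‖ ≤ N * ‖y‖) (fun y hy => ?_)
    (isClosed_le (by fun_prop) (by fun_prop)) y
  obtain ⟨C, hC⟩ := h y hy
  by_contra! hlt
  have hconv : ∀ n, ‖(T ^ (n + 1)) y‖ ^ 2 ≤ ‖(T ^ n) y‖ * ‖(T ^ (n + 2)) y‖ := by
    intro n
    have hsymm := (ContinuousLinearMap.isSelfAdjoint_iff_isSymmetric.mp hT)
    have h1 : ⟪(T ^ (n + 1)) y, (T ^ (n + 1)) y⟫_ℂ = ⟪(T ^ n) y, (T ^ (n + 2)) y⟫_ℂ := by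
      rw [pow_succ' T (n + 1), pow_succ' T n]
      exact hsymm _ _
    have h2 := norm_inner_le_norm (𝕜 := ℂ) ((T ^ n) y) ((T ^ (n + 2)) y)
    rw [← h1, inner_self_eq_norm_sq_to_K] at h2
    simpa using h2
  have hy0 : 0 < ‖y‖ := norm_pos_iff.mpr fun h0 => by simp [h0] at hlt
  set r := ‖T y‖ / ‖y‖ with hr
  have hNr : N < r := (lt_div_iff₀ hy0).mpr hlt
  have hr0 : 0 < r := hN.trans_lt hNr
  have hstep : ∀ n, 0 < ‖(T ^ n) y‖ ∧ r * ‖(T ^ n) y‖ ≤ ‖(T ^ (n + 1)) y‖ := by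
    intro n
    induction n with
    | zero => simpa [hr, hy0.ne'] using hy0
    | succ n ih =>
      have hpos : 0 < ‖(T ^ (n + 1)) y‖ := (mul_pos hr0 ih.1).trans_le ih.2
      refine ⟨hpos, le_of_mul_le_mul_left ?_ ih.1⟩
      calc ‖(T ^ n) y‖ * (r * ‖(T ^ (n + 1)) y‖) = r * ‖(T ^ n) y‖ * ‖(T ^ (n + 1)) y‖ := by ring
        _ ≤ ‖(T ^ (n + 1)) y‖ ^ 2 := by rw [sq]; gcongr; exact ih.2
        _ ≤ _ := hconv n
  have hgrow : ∀ n, r ^ n * ‖y‖ ≤ ‖(T ^ n) y‖ := by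
    intro n
    induction n with
    | zero => simp
    | succ n ih =>
      calc r ^ (n + 1) * ‖y‖ = r * (r ^ n * ‖y‖) := by ring
        _ ≤ r * ‖(T ^ n) y‖ := by gcongr
        _ ≤ _ := (hstep n).2
  have hlim : Filter.Tendsto (fun n : ℕ => C * (N / r) ^ n) Filter.atTop (𝓝 (C * 0)) :=
    (tendsto_pow_atTop_nhds_zero_of_lt_one (by positivity) ((div_lt_one hr0).mpr hNr)).const_mul C
  rw [mul_zero] at hlim
  refine hy0.not_ge (ge_of_tendsto' hlim fun n => ?_)
  rw [div_pow, ← mul_div_assoc, le_div_iff₀ (by positivity), mul_comm]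
  exact (hgrow n).trans (hC n)

variable {ι : Type*} [CompleteSpace X] [CompleteSpace Y]

/-- `T` and `T*` are intertwined with `S` and `S*` by all operators `V i`. -/
def Intertwines (V : ι → X →L[ℂ] Y) (S : X →L[ℂ] X) (T : Y →L[ℂ] Y) : Prop :=
  ∀ i x, V i (S x) = T (V i x) ∧ V i (star S x) = star T (V i x)

namespace Intertwines

variable {V : ι → X →L[ℂ] Y} {S S' : X →L[ℂ] X} {T T' : Y →L[ℂ] Y}

theorem star_star (h : Intertwines V S T) : Intertwines V (star S) (star T) := fun i x =>
  ⟨(h i x).2, by simpa using (h i x).1⟩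

theorem mul (h : Intertwines V S T) (h' : Intertwines V S' T') :
    Intertwines V (S * S') (T * T') := fun i x =>
  ⟨by simp [(h i _).1, (h' i _).1], by simp [(h i _).2, (h' i _).2]⟩

theorem add (h : Intertwines V S T) (h' : Intertwines V S' T') :
    Intertwines V (S + S') (T + T') := fun i x =>
  ⟨by simp [(h i _).1, (h' i _).1], by simp [(h i _).2, (h' i _).2]⟩

theorem sub (h : Intertwines V S T) (h' : Intertwines V S' T') :
    Intertwines V (S - S') (T - T') := fun i x =>
  ⟨by simp [(h i _).1, (h' i _).1], by simp [(h i _).2, (h' i _).2]⟩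

theorem of_algebraMap (V : ι → X →L[ℂ] Y) (c : ℂ) :
    Intertwines V (algebraMap ℂ (X →L[ℂ] X) c) (algebraMap ℂ (Y →L[ℂ] Y) c) := fun i x =>
  ⟨by simp [Algebra.algebraMap_eq_smul_one], by simp [Algebra.algebraMap_eq_smul_one]⟩

/-- Intertwined operators are dominated: `‖(T* T)ⁿ V x‖ = ‖V (S* S)ⁿ x‖` grows at most like
`‖S* S‖ⁿ`. -/
theorem norm_le (hV : Dense (Submodule.span ℂ (⋃ i, Set.range (V i)) : Set Y))
    (h : Intertwines V S T) : ‖T‖ ≤ ‖S‖ := by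
  have hpow : ∀ n : ℕ, ∀ i x, ((star T * T) ^ n) (V i x) = V i (((star S * S) ^ n) x) := by
    intro n
    induction n with
    | zero => simp
    | succ n ih =>
      intro i x
      calc ((star T * T) ^ (n + 1)) (V i x) = ((star T * T) ^ n) ((star T * T) (V i x)) := by
            rw [pow_succ]; rfl
        _ = ((star T * T) ^ n) (V i ((star S * S) x)) :=
            congrArg _ ((h.star_star.mul h) i x).1.symm
        _ = _ := by rw [ih, pow_succ]; rfl
  have key : ‖star T * T‖ ≤ ‖star S * S‖ := by
    refine (IsSelfAdjoint.star_mul_self T).norm_le_of_growth (norm_nonneg _) hV fun y hy => ?_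
    induction hy using Submodule.span_induction with
    | mem y hy =>
      obtain ⟨i, x, rfl⟩ := Set.mem_iUnion.mp hy
      refine ⟨‖V i‖ * ‖x‖, fun n => ?_⟩
      rw [hpow]
      calc ‖V i (((star S * S) ^ n) x)‖ ≤ ‖V i‖ * (‖(star S * S) ^ n‖ * ‖x‖) :=
            (V i).le_opNorm_of_le (ContinuousLinearMap.le_opNorm _ _)
        _ ≤ ‖V i‖ * (‖star S * S‖ ^ n * ‖x‖) := by
            rcases n.eq_zero_or_pos with rfl | hn
            · gcongr
              exact ContinuousLinearMap.norm_id_le (𝕜 := ℂ) (E := X)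
            · gcongr
              exact norm_pow_le' _ hn
        _ = _ := by ring
    | zero => exact ⟨0, fun n => by rw [map_zero, norm_zero, zero_mul]⟩
    | add y z _ _ hy hz =>
      obtain ⟨C, hC⟩ := hy
      obtain ⟨C', hC'⟩ := hz
      refine ⟨C + C', fun n => ?_⟩
      rw [map_add, add_mul]
      exact (norm_add_le _ _).trans (add_le_add (hC n) (hC' n))
    | smul c y _ hy =>
      obtain ⟨C, hC⟩ := hy
      refine ⟨‖c‖ * C, fun n => ?_⟩
      rw [map_smul, norm_smul, mul_assoc]
      gcongr
      exact hC n
  rw [CStarRing.norm_star_mul_self, CStarRing.norm_star_mul_self] at key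
  exact (mul_self_le_mul_self_iff (norm_nonneg _) (norm_nonneg _)).mpr key

theorem unique (hV : Dense (Submodule.span ℂ (⋃ i, Set.range (V i)) : Set Y))
    (h : Intertwines V S T) (h' : Intertwines V S T') : T = T' := by
  have h0 := (h.sub h').norm_le hV
  rw [sub_self, norm_zero] at h0
  exact sub_eq_zero.mp (norm_le_zero_iff.mp h0)

end Intertwines

/-- The operators on `X` that have a counterpart on `Y` with respect to the maps `V i`. -/
def intertwinable (V : ι → X →L[ℂ] Y) : StarSubalgebra ℂ (X →L[ℂ] X) where
  carrier := {S | ∃ T, Intertwines V S T}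
  mul_mem' := fun ⟨T, h⟩ ⟨T', h'⟩ => ⟨T * T', h.mul h'⟩
  add_mem' := fun ⟨T, h⟩ ⟨T', h'⟩ => ⟨T + T', h.add h'⟩
  algebraMap_mem' c := ⟨_, Intertwines.of_algebraMap V c⟩
  star_mem' := fun ⟨T, h⟩ => ⟨star T, h.star_star⟩

theorem tendsto_clm_apply {E : Type*} [NormedAddCommGroup E] [InnerProductSpace ℂ E]
    {a : ℕ → E →L[ℂ] E} {b : E →L[ℂ] E} (h : Filter.Tendsto a Filter.atTop (𝓝 b)) (x : E) :
    Filter.Tendsto (fun n => a n x) Filter.atTop (𝓝 (b x)) :=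
  ((ContinuousLinearMap.apply ℂ E x).continuous.tendsto b).comp h

/-- The counterparts on `Y` of a Cauchy sequence on `X` form a Cauchy sequence by
`Intertwines.norm_le`. -/
theorem isClosed_intertwinable {V : ι → X →L[ℂ] Y}
    (hV : Dense (Submodule.span ℂ (⋃ i, Set.range (V i)) : Set Y)) :
    IsClosed (intertwinable V : Set (X →L[ℂ] X)) := by
  refine isClosed_of_closure_subset fun S hS => ?_
  obtain ⟨s, hs, hlim⟩ := mem_closure_iff_seq_limit.mp hS
  have hs' : ∀ n, ∃ T, Intertwines V (s n) T := hs
  choose t ht using hs'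
  have hc : CauchySeq t := by
    refine Metric.cauchySeq_iff.mpr fun ε hε => ?_
    obtain ⟨N, hN⟩ := Metric.cauchySeq_iff.mp hlim.cauchySeq ε hε
    refine ⟨N, fun m hm n hn => ?_⟩
    rw [dist_eq_norm]
    exact (((ht m).sub (ht n)).norm_le hV).trans_lt (dist_eq_norm (s m) (s n) ▸ hN m hm n hn)
  obtain ⟨T, hT⟩ := cauchySeq_tendsto_of_complete hc
  refine ⟨T, fun i x => ⟨?_, ?_⟩⟩
  · refine tendsto_nhds_unique (((V i).continuous.tendsto _).comp (tendsto_clm_apply hlim x)) ?_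
    refine (tendsto_clm_apply hT (V i x)).congr fun n => ?_
    exact ((ht n) i x).1.symm
  · refine tendsto_nhds_unique (((V i).continuous.tendsto _).comp (tendsto_clm_apply hlim.star x)) ?_
    refine (tendsto_clm_apply hT.star (V i x)).congr fun n => ?_
    exact ((ht n) i x).2.symm

/-- Passing to the counterpart on `Y`, which is unique, is a homomorphism. -/
theorem exists_starAlgHom_intertwines {V : ι → X →L[ℂ] Y}
    (hV : Dense (Submodule.span ℂ (⋃ i, Set.range (V i)) : Set Y))
    (𝒮 : StarSubalgebra ℂ (X →L[ℂ] X)) (h𝒮 : 𝒮 ≤ intertwinable V) :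
    ∃ Φ : 𝒮 →⋆ₐ[ℂ] (Y →L[ℂ] Y), ∀ S : 𝒮, Intertwines V (S : X →L[ℂ] X) (Φ S) := by
  have h : ∀ S : 𝒮, ∃ T, Intertwines V (S : X →L[ℂ] X) T := fun S => h𝒮 S.2
  choose f hf using h
  exact ⟨{
    toFun := f
    map_one' := (hf 1).unique hV (by simpa using Intertwines.of_algebraMap V 1)
    map_mul' := fun a b => (hf (a * b)).unique hV ((hf a).mul (hf b))
    map_zero' := (hf 0).unique hV (by simpa using Intertwines.of_algebraMap V 0)
    map_add' := fun a b => (hf (a + b)).unique hV ((hf a).add (hf b))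
    commutes' := fun c => (hf _).unique hV (Intertwines.of_algebraMap V c)
    map_star' := fun a => (hf (star a)).unique hV (hf a).star_star }, hf⟩

end Intertwining

/-! ### Maps between Hilbert space tensor products -/

section HilbertTensorMaps

variable {H K H' K' L : Type*} [NormedAddCommGroup H] [InnerProductSpace ℂ H]
  [NormedAddCommGroup K] [InnerProductSpace ℂ K]
  [NormedAddCommGroup H'] [InnerProductSpace ℂ H']
  [NormedAddCommGroup K'] [InnerProductSpace ℂ K']
  [NormedAddCommGroup L] [InnerProductSpace ℂ L]

/-- The elementary tensor `x ⊗ y` in the Hilbert space tensor product. -/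
noncomputable def hilbertTmul (x : H) (y : K) : HilbertTensor H K :=
  toHilbertTensor H K (x ⊗ₜ y)

theorem inner_hilbertTmul (x x' : H) (y y' : K) :
    ⟪hilbertTmul x y, hilbertTmul x' y'⟫_ℂ = ⟪x, x'⟫_ℂ * ⟪y, y'⟫_ℂ := by
  simp [hilbertTmul]

theorem dense_span_hilbertTmul :
    Dense (Submodule.span ℂ {z : HilbertTensor H K | ∃ x y, z = hilbertTmul x y} :
      Set (HilbertTensor H K)) := by
  refine (denseRange_toHilbertTensor H K).mono ?_
  rintro _ ⟨t, rfl⟩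
  induction t with
  | zero => simp
  | add s t hs ht => rw [map_add]; exact Submodule.add_mem _ hs ht
  | tmul x y => exact Submodule.subset_span ⟨x, y, rfl⟩

/-- Induction for a property of vectors stable under sums and limits. -/
theorem hilbertTensor_induction {P : HilbertTensor H K → Prop} (hP : IsClosed {z | P z})
    (tmul : ∀ x y, P (hilbertTmul x y)) (add : ∀ z w, P z → P w → P (z + w)) (z) : P z := by
  refine (denseRange_toHilbertTensor H K).induction_on z hP fun t => ?_
  induction t with
  | zero => simpa [hilbertTmul] using tmul 0 0
  | add s t hs ht => rw [map_add]; exact add _ _ hs ht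
  | tmul x y => exact tmul x y

theorem opTensor_hilbertTmul (S : H →L[ℂ] H) (T : K →L[ℂ] K) (x : H) (y : K) :
    opTensor S T (hilbertTmul x y) = hilbertTmul (S x) (T y) :=
  opTensor_apply S T _

/-- The operator `S ⊗ T` between different Hilbert space tensor products. -/
noncomputable def opTensorMap (S : H →L[ℂ] H') (T : K →L[ℂ] K') :
    HilbertTensor H K →L[ℂ] HilbertTensor H' K' :=
  (TensorProduct.mapL S T).completion

theorem opTensorMap_hilbertTmul (S : H →L[ℂ] H') (T : K →L[ℂ] K') (x : H) (y : K) :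
    opTensorMap S T (hilbertTmul x y) = hilbertTmul (S x) (T y) :=
  (TensorProduct.mapL S T).completion_apply_coe (x ⊗ₜ y)

theorem hilbertTmul_add_left (x x' : H) (y : K) :
    hilbertTmul (x + x') y = hilbertTmul x y + hilbertTmul x' y := by
  simp [hilbertTmul, TensorProduct.add_tmul]

theorem hilbertTmul_add_right (x : H) (y y' : K) :
    hilbertTmul x (y + y') = hilbertTmul x y + hilbertTmul x y' := by
  simp [hilbertTmul, TensorProduct.tmul_add]

theorem hilbertTmul_smul_left (c : ℂ) (x : H) (y : K) :
    hilbertTmul (c • x) y = c • hilbertTmul x y := by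
  rw [hilbertTmul, hilbertTmul, ← map_smul, TensorProduct.smul_tmul']

theorem hilbertTmul_smul_right (c : ℂ) (x : H) (y : K) :
    hilbertTmul x (c • y) = c • hilbertTmul x y := by
  simp [hilbertTmul]

theorem norm_hilbertTmul (x : H) (y : K) : ‖hilbertTmul x y‖ = ‖x‖ * ‖y‖ := by
  simp [hilbertTmul]

/-- The operator `y ↦ x ⊗ y`. -/
noncomputable def tmulLeftL (x : H) : K →L[ℂ] HilbertTensor H K :=
  LinearMap.mkContinuous
    { toFun := hilbertTmul x
      map_add' := hilbertTmul_add_right x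
      map_smul' := fun c => hilbertTmul_smul_right c x } ‖x‖ fun y => (norm_hilbertTmul x y).le

@[simp]
theorem tmulLeftL_apply (x : H) (y : K) : tmulLeftL x y = hilbertTmul x y := rfl

/-- The operator `x ↦ x ⊗ y`. -/
noncomputable def tmulRightL (y : K) : H →L[ℂ] HilbertTensor H K :=
  LinearMap.mkContinuous
    { toFun := fun x => hilbertTmul x y
      map_add' := fun x x' => hilbertTmul_add_left x x' y
      map_smul' := fun c x => hilbertTmul_smul_left c x y } ‖y‖
    fun x => by rw [mul_comm]; exact (norm_hilbertTmul x y).le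

@[simp]
theorem tmulRightL_apply (x : H) (y : K) : tmulRightL y x = hilbertTmul x y := rfl

variable (H K L)

/-- The flip `x ⊗ y ↦ y ⊗ x`. -/
noncomputable def hilbertComm : HilbertTensor H K →L[ℂ] HilbertTensor K H :=
  ((TensorProduct.commIsometry ℂ H K).toContinuousLinearEquiv :
    H ⊗[ℂ] K →L[ℂ] K ⊗[ℂ] H).completion

variable {H K L} in
theorem hilbertComm_hilbertTmul (x : H) (y : K) :
    hilbertComm H K (hilbertTmul x y) = hilbertTmul y x :=
  ((TensorProduct.commIsometry ℂ H K).toContinuousLinearEquiv :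
    H ⊗[ℂ] K →L[ℂ] K ⊗[ℂ] H).completion_apply_coe (x ⊗ₜ y)

variable {H K L} in
theorem opTensorMap_add_right (S : H →L[ℂ] H') (T T' : K →L[ℂ] K') :
    opTensorMap S (T + T') = opTensorMap S T + opTensorMap S T' := by
  ext z
  induction z using hilbertTensor_induction with
  | hP => exact isClosed_eq (by fun_prop) (by fun_prop)
  | tmul x y => simp [opTensorMap_hilbertTmul, hilbertTmul_add_right]
  | add z w hz hw => rw [map_add, map_add, hz, hw]

variable {H K L} in
theorem opTensorMap_smul_right (c : ℂ) (S : H →L[ℂ] H') (T : K →L[ℂ] K') :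
    opTensorMap S (c • T) = c • opTensorMap S T := by
  ext z
  induction z using hilbertTensor_induction with
  | hP => exact isClosed_eq (ContinuousLinearMap.continuous _) (ContinuousLinearMap.continuous _)
  | tmul x y => simp [opTensorMap_hilbertTmul, hilbertTmul_smul_right]
  | add z w hz hw => rw [map_add, map_add, hz, hw]

/-- The operators `x ⊗ y ↦ x ⊗ (y ⊗ l)`, depending linearly on `l`. -/
noncomputable def tmulAssocL :
    L →ₗ[ℂ] (HilbertTensor H K →L[ℂ] HilbertTensor H (HilbertTensor K L)) where
  toFun l := opTensorMap (ContinuousLinearMap.id ℂ H) (tmulRightL l)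
  map_add' l l' := by
    rw [← opTensorMap_add_right]
    congr 1
    ext y
    exact hilbertTmul_add_right _ _ _
  map_smul' c l := by
    rw [RingHom.id_apply, ← opTensorMap_smul_right]
    congr 1
    ext y
    exact hilbertTmul_smul_right _ _ _

/-- The associator on the partially completed tensor product, sending `z ⊗ l` to the image of `z`
under `x ⊗ y ↦ x ⊗ (y ⊗ l)`. -/
noncomputable def hilbertAssocAux :
    (HilbertTensor H K) ⊗[ℂ] L →ₗ[ℂ] HilbertTensor H (HilbertTensor K L) :=
  TensorProduct.lift ((ContinuousLinearMap.coeLM ℂ).comp (tmulAssocL H K L)).flip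

theorem hilbertAssocAux_tmul (z : HilbertTensor H K) (l : L) :
    hilbertAssocAux H K L (z ⊗ₜ l) =
      opTensorMap (ContinuousLinearMap.id ℂ H) (tmulRightL l) z := rfl

theorem inner_hilbertAssocAux (s t : (HilbertTensor H K) ⊗[ℂ] L) :
    ⟪hilbertAssocAux H K L s, hilbertAssocAux H K L t⟫_ℂ = ⟪s, t⟫_ℂ := by
  induction s with
  | zero => simp
  | add s s' hs hs' => simp only [map_add, inner_add_left, hs, hs']
  | tmul z l =>
    induction t with
    | zero => simp
    | add t t' ht ht' => simp only [map_add, inner_add_right, ht, ht']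
    | tmul w m =>
      rw [hilbertAssocAux_tmul, hilbertAssocAux_tmul, TensorProduct.inner_tmul]
      induction z using hilbertTensor_induction with
      | hP => exact isClosed_eq (by fun_prop) (by fun_prop)
      | add z z' hz hz' => simp only [map_add, inner_add_left, hz, hz', add_mul]
      | tmul x y =>
        induction w using hilbertTensor_induction with
        | hP => exact isClosed_eq (by fun_prop) (by fun_prop)
        | add z z' hz hz' => simp only [map_add, inner_add_right, hz, hz', add_mul]
        | tmul x' y' =>
          simp only [opTensorMap_hilbertTmul, tmulRightL_apply, inner_hilbertTmul,
            ContinuousLinearMap.id_apply, mul_assoc]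

/-- The associator `(x ⊗ y) ⊗ l ↦ x ⊗ (y ⊗ l)`. -/
noncomputable def hilbertAssoc :
    HilbertTensor (HilbertTensor H K) L →L[ℂ] HilbertTensor H (HilbertTensor K L) :=
  (hilbertAssocAux H K L).extendOfNorm (toHilbertTensor (HilbertTensor H K) L).toLinearMap

variable {H K L} in
theorem hilbertAssoc_hilbertTmul (x : H) (y : K) (l : L) :
    hilbertAssoc H K L (hilbertTmul (hilbertTmul x y) l) = hilbertTmul x (hilbertTmul y l) := by
  have h := LinearMap.extendOfNorm_eq (f := hilbertAssocAux H K L)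
    (e := (toHilbertTensor (HilbertTensor H K) L).toLinearMap) (denseRange_toHilbertTensor _ _)
    ⟨1, fun t => by
      rw [one_mul]
      refine le_of_eq ?_
      exact (((hilbertAssocAux H K L).isometryOfInner (inner_hilbertAssocAux H K L)).norm_map
        t).trans ((toHilbertTensor (HilbertTensor H K) L).norm_map t).symm⟩ (hilbertTmul x y ⊗ₜ l)
  refine h.trans ?_
  rw [hilbertAssocAux_tmul, opTensorMap_hilbertTmul]
  rfl

end HilbertTensorMaps

/-! ### Vectors of a representation as images of GNS vectors -/

section GNSIntertwiner

variable {A H : Type*} [CStarAlgebra A] [NormedAddCommGroup H] [InnerProductSpace ℂ H]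
  [CompleteSpace H]

/-- The positive functional `a ↦ ⟪ξ, π a ξ⟫` of a vector in a representation. -/
noncomputable def vectorFunctional (π : A →⋆ₐ[ℂ] (H →L[ℂ] H)) (ξ : H) : PosFunctional A :=
  letI := CStarAlgebra.spectralOrder A
  letI := CStarAlgebra.spectralOrderedRing A
  PositiveLinearMap.mk₀
    { toFun := fun a => ⟪ξ, π a ξ⟫_ℂ
      map_add' := fun a b => by simp
      map_smul' := fun c a => by simp }
    (fun a ha => by
      obtain ⟨b, rfl⟩ := CStarAlgebra.nonneg_iff_eq_star_mul_self.mp ha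
      change 0 ≤ ⟪ξ, π (star b * b) ξ⟫_ℂ
      rw [map_mul, map_star, ContinuousLinearMap.star_eq_adjoint, mul_apply_eq_comp,
        ContinuousLinearMap.adjoint_inner_right, inner_self_eq_norm_sq_to_K]
      rw [← RCLike.ofReal_pow]
      exact Complex.zero_le_real.mpr (sq_nonneg ‖π b ξ‖))

/-- Every vector of a representation lies in the range of a bounded intertwiner from the universal
representation: that of the GNS space of its vector functional. -/
theorem exists_universal_intertwiner (π : A →⋆ₐ[ℂ] (H →L[ℂ] H)) (ξ : H) :
    ∃ V : UniversalSpace A →L[ℂ] H, (∀ a x, V (universalRep A a x) = π a (V x)) ∧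
      ∃ x, V x = ξ := by
  classical
  let := CStarAlgebra.spectralOrder A
  let := CStarAlgebra.spectralOrderedRing A
  let f : PosFunctional A := vectorFunctional π ξ
  let W₀ : f.PreGNS →ₗ[ℂ] H :=
    { toFun := fun a => π (f.ofPreGNS a) ξ
      map_add' := fun a b => by simp
      map_smul' := fun c a => by simp }
  let e : f.PreGNS →ₗ[ℂ] GNSSpace f :=
    (UniformSpace.Completion.toComplₗᵢ (𝕜 := ℂ) (E := f.PreGNS)).toLinearMap
  have he : DenseRange e := UniformSpace.Completion.denseRange_coe (α := f.PreGNS)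
  have hnorm : ∀ a, ‖W₀ a‖ = ‖e a‖ := by
    intro a
    have h1 : ‖e a‖ = ‖a‖ := UniformSpace.Completion.norm_coe a
    have h2 : ((‖a‖ ^ 2 : ℝ) : ℂ) = ((‖W₀ a‖ ^ 2 : ℝ) : ℂ) := by
      rw [Complex.ofReal_pow, PositiveLinearMap.preGNS_norm_sq]
      change ⟪ξ, π (star (f.ofPreGNS a) * f.ofPreGNS a) ξ⟫_ℂ = _
      rw [map_mul, map_star, ContinuousLinearMap.star_eq_adjoint, mul_apply_eq_comp,
        ContinuousLinearMap.adjoint_inner_right, inner_self_eq_norm_sq_to_K]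
      simp [W₀]
    rw [h1]
    exact ((sq_eq_sq₀ (norm_nonneg _) (norm_nonneg _)).mp (mod_cast h2)).symm
  let W : GNSSpace f →L[ℂ] H := W₀.extendOfNorm e
  have hW : ∀ a, W (e a) = W₀ a :=
    LinearMap.extendOfNorm_eq he ⟨1, fun a => by rw [one_mul, hnorm]⟩
  have hint : ∀ a y, W (gnsRep f a y) = π a (W y) := by
    intro a y
    refine he.induction_on y (isClosed_eq (by fun_prop) (by fun_prop)) fun b => ?_
    have h3 : gnsRep f a (e b) = e (f.toPreGNS (a * f.ofPreGNS b)) :=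
      PositiveLinearMap.gnsNonUnitalStarAlgHom_apply_coe f
    rw [h3, hW, hW]
    simp [W₀]
  refine ⟨W ∘L lp.evalCLM ℂ (fun g : PosFunctional A => GNSSpace g) 2 f, fun a x => hint a (x f),
    lp.single 2 f (e (f.toPreGNS 1)), ?_⟩
  have h4 : lp.evalCLM ℂ (fun g : PosFunctional A => GNSSpace g) 2 f
      (lp.single 2 f (e (f.toPreGNS 1))) = e (f.toPreGNS 1) := by
    simp [lp.evalCLM]
  rw [ContinuousLinearMap.comp_apply, h4, hW]
  simp [W₀]

end GNSIntertwiner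

/-! ### Elementary properties of the minimal tensor product -/

section CStarTensorBasic

variable {A B : Type*} [CStarAlgebra A] [CStarAlgebra B]

/-- The second-factor embedding `b ↦ 1 ⊗ b`. -/
noncomputable def tensorOneLeft (A B : Type*) [CStarAlgebra A] [CStarAlgebra B] :
    B →⋆ₐ[ℂ] CStarTensor A B :=
  ((ampRight _ _).comp (universalRep B)).codRestrict
    (spatialTensor (universalRep A) (universalRep B)) fun b =>
      StarSubalgebra.le_topologicalClosure _ (le_sup_right (a := StarAlgHom.range _) ⟨b, rfl⟩)

/-- The defining representation of `A ⊗ B` on the tensor product of the universal spaces. -/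
noncomputable def CStarTensor.rep (A B : Type*) [CStarAlgebra A] [CStarAlgebra B] :
    CStarTensor A B →⋆ₐ[ℂ] (HilbertTensor (UniversalSpace A) (UniversalSpace B) →L[ℂ]
      HilbertTensor (UniversalSpace A) (UniversalSpace B)) :=
  (spatialTensor (universalRep A) (universalRep B)).subtype

namespace CStarTensor

theorem rep_injective : Function.Injective (rep A B) := Subtype.val_injective

theorem isometry_rep : Isometry (rep A B) := isometry_subtype_coe

theorem rep_tensorOneRight (a : A) :
    rep A B (tensorOneRight A B a) = ampLeft _ _ (universalRep A a) := rfl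

theorem rep_tensorOneLeft (b : B) :
    rep A B (tensorOneLeft A B b) = ampRight _ _ (universalRep B b) := rfl

theorem ampLeft_mul_ampRight {H K : Type*} [NormedAddCommGroup H] [InnerProductSpace ℂ H]
    [NormedAddCommGroup K] [InnerProductSpace ℂ K] [CompleteSpace H] [CompleteSpace K]
    (S : H →L[ℂ] H) (T : K →L[ℂ] K) : ampLeft H K S * ampRight H K T = opTensor S T := by
  change opTensor S 1 * opTensor 1 T = _
  rw [← opTensor_mul, mul_one, one_mul]

theorem commute_tensorOneRight_tensorOneLeft (a : A) (b : B) :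
    Commute (tensorOneRight A B a) (tensorOneLeft A B b) := by
  refine rep_injective ?_
  rw [map_mul, map_mul, rep_tensorOneRight, rep_tensorOneLeft, ampLeft_mul_ampRight]
  change _ = opTensor 1 _ * opTensor _ 1
  rw [← opTensor_mul, mul_one, one_mul]

/-- The elementary tensor `a ⊗ b`. -/
noncomputable def tmul (a : A) (b : B) : CStarTensor A B :=
  tensorOneRight A B a * tensorOneLeft A B b

theorem rep_tmul (a : A) (b : B) :
    rep A B (tmul a b) = opTensor (universalRep A a) (universalRep B b) := by
  rw [tmul, map_mul, rep_tensorOneRight, rep_tensorOneLeft, ampLeft_mul_ampRight]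

theorem tmul_mul_tmul (a a' : A) (b b' : B) :
    tmul a b * tmul a' b' = tmul (a * a') (b * b') := by
  rw [tmul, tmul, tmul, map_mul, map_mul]
  exact (commute_tensorOneRight_tensorOneLeft a' b).symm.mul_mul_mul_comm _ _

theorem tmul_one (a : A) : tmul a (1 : B) = tensorOneRight A B a := by
  rw [tmul, map_one, mul_one]

theorem one_tmul (b : B) : tmul (1 : A) b = tensorOneLeft A B b := by
  rw [tmul, map_one, one_mul]

theorem star_tmul (a : A) (b : B) : star (tmul a b) = tmul (star a) (star b) := by
  rw [tmul, tmul, star_mul, map_star, map_star]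
  exact ((commute_tensorOneRight_tensorOneLeft (star a) (star b)).eq.trans
    (by rw [map_star, map_star])).symm.trans (by rw [map_star, map_star])

theorem smul_tmul (c : ℂ) (a : A) (b : B) : c • tmul a b = tmul (c • a) b := by
  rw [tmul, tmul, map_smul, smul_mul_assoc]

/-- The span of the elementary tensors, as a star subalgebra. -/
noncomputable def algebraic (A B : Type*) [CStarAlgebra A] [CStarAlgebra B] :
    StarSubalgebra ℂ (CStarTensor A B) where
  carrier := Submodule.span ℂ (Set.range fun p : A × B => tmul p.1 p.2)
  mul_mem' {x y} hx hy := by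
    induction hx, hy using Submodule.span_induction₂ with
    | mem_mem x y hx hy =>
      obtain ⟨p, rfl⟩ := hx
      obtain ⟨q, rfl⟩ := hy
      exact Submodule.subset_span ⟨(p.1 * q.1, p.2 * q.2), (tmul_mul_tmul _ _ _ _).symm⟩
    | zero_left y hy => simp
    | zero_right x hx => simp
    | add_left x y z _ _ _ hx hy => rw [add_mul]; exact Submodule.add_mem _ hx hy
    | add_right x y z _ _ _ hx hy => rw [mul_add]; exact Submodule.add_mem _ hx hy
    | smul_left r x y _ _ h => rw [smul_mul_assoc]; exact Submodule.smul_mem _ _ h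
    | smul_right r x y _ _ h => rw [mul_smul_comm]; exact Submodule.smul_mem _ _ h
  add_mem' hx hy := Submodule.add_mem _ hx hy
  algebraMap_mem' c := by
    rw [Algebra.algebraMap_eq_smul_one]
    exact Submodule.smul_mem _ _ (Submodule.subset_span ⟨(1, 1), by simp [tmul]⟩)
  star_mem' {x} hx := by
    induction hx using Submodule.span_induction with
    | mem x hx =>
      obtain ⟨p, rfl⟩ := hx
      exact Submodule.subset_span ⟨(star p.1, star p.2), (star_tmul _ _).symm⟩
    | zero => simp
    | add x y _ _ hx hy => rw [star_add]; exact Submodule.add_mem _ hx hy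
    | smul c x _ hx => rw [star_smul]; exact Submodule.smul_mem _ _ hx

theorem dense_algebraic : Dense (algebraic A B : Set (CStarTensor A B)) := by
  intro z
  have hle : ((ampLeft _ _).comp (universalRep A)).range ⊔
      ((ampRight _ _).comp (universalRep B)).range ≤ (algebraic A B).map (rep A B) := by
    refine sup_le ?_ ?_
    · rintro _ ⟨a, rfl⟩
      exact ⟨tensorOneRight A B a, Submodule.subset_span ⟨(a, 1), tmul_one a⟩, rfl⟩
    · rintro _ ⟨b, rfl⟩
      exact ⟨tensorOneLeft A B b, Submodule.subset_span ⟨(1, b), one_tmul b⟩, rfl⟩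
  rw [isometry_rep.isUniformInducing.isInducing.closure_eq_preimage_closure_image]
  exact closure_mono hle z.2

/-- A property of elements of `A ⊗ B` that is stable under sums and limits and holds for
elementary tensors holds everywhere. -/
theorem induction_on {P : CStarTensor A B → Prop} (z : CStarTensor A B)
    (hP : IsClosed {z | P z}) (tmul : ∀ a b, P (tmul a b))
    (add : ∀ z w, P z → P w → P (z + w)) : P z := by
  refine dense_algebraic.induction (P := P) (fun w hw => ?_) hP z
  suffices h : ∀ c : ℂ, P (c • w) by simpa using h 1
  induction hw using Submodule.span_induction with
  | mem x hx => obtain ⟨p, rfl⟩ := hx; exact fun c => smul_tmul c p.1 p.2 ▸ tmul _ _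
  | zero => simpa [CStarTensor.tmul] using tmul 0 0
  | add x y _ _ hx hy => exact fun c => smul_add c x y ▸ add _ _ (hx c) (hy c)
  | smul c' x _ h => exact fun c => smul_smul c c' x ▸ h _

theorem continuous_starAlgHom {C E : Type*} [CStarAlgebra C] [CStarAlgebra E]
    (f : C →⋆ₐ[ℂ] E) : Continuous f :=
  AddMonoidHomClass.continuous_of_bound f 1 fun x => by
    simpa using NonUnitalStarAlgHom.norm_apply_le f x

end CStarTensor

end CStarTensorBasic

/-! ### Homomorphisms out of the minimal tensor product -/

section CStarTensorMaps

namespace CStarTensor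

variable {A B C E : Type*} [CStarAlgebra A] [CStarAlgebra B] [CStarAlgebra C] [CStarAlgebra E]

/-- Transport of a representation of `A ⊗ B` from `X` to `Y` along a total family of maps that
intertwine it, on elementary tensors, with given operators on `Y`. -/
theorem exists_transport {ι X Y : Type*} [NormedAddCommGroup X] [InnerProductSpace ℂ X]
    [CompleteSpace X] [NormedAddCommGroup Y] [InnerProductSpace ℂ Y] [CompleteSpace Y]
    {V : ι → X →L[ℂ] Y} (hV : Dense (Submodule.span ℂ (⋃ i, Set.range (V i)) : Set Y))
    (Φ : CStarTensor A B →⋆ₐ[ℂ] (X →L[ℂ] X)) (Θ : A → B → Y →L[ℂ] Y)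
    (hΘ : ∀ a b, star (Θ a b) = Θ (star a) (star b))
    (h : ∀ a b i x, V i (Φ (tmul a b) x) = Θ a b (V i x)) :
    ∃ Φ' : CStarTensor A B →⋆ₐ[ℂ] (Y →L[ℂ] Y), ∀ a b, Φ' (tmul a b) = Θ a b := by
  have hint : ∀ a b, Intertwines V (Φ (tmul a b)) (Θ a b) := fun a b i x =>
    ⟨h a b i x, by rw [hΘ, ← map_star, star_tmul, h]⟩
  have hmem : ∀ z, Φ z ∈ intertwinable V := by
    intro z
    induction z using induction_on with
    | hP => exact (isClosed_intertwinable hV).preimage (continuous_starAlgHom Φ)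
    | tmul a b => exact ⟨_, hint a b⟩
    | add z w hz hw => rw [map_add]; exact add_mem hz hw
  have hle : Φ.range ≤ intertwinable V := by
    rintro _ ⟨z, rfl⟩
    exact hmem z
  obtain ⟨Ψ, hΨ⟩ := exists_starAlgHom_intertwines hV _ hle
  exact ⟨Ψ.comp Φ.rangeRestrict, fun a b => (hΨ (Φ.rangeRestrict (tmul a b))).unique hV (hint a b)⟩

/-- Any pair of representations induces a representation of the minimal tensor product: its vectors
are reached from the universal spaces by intertwiners `V ⊗ W`. -/
theorem exists_hom_of_reps {H K : Type*} [NormedAddCommGroup H] [InnerProductSpace ℂ H]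
    [CompleteSpace H] [NormedAddCommGroup K] [InnerProductSpace ℂ K] [CompleteSpace K]
    (π : A →⋆ₐ[ℂ] (H →L[ℂ] H)) (ρ : B →⋆ₐ[ℂ] (K →L[ℂ] K)) :
    ∃ Φ : CStarTensor A B →⋆ₐ[ℂ] (HilbertTensor H K →L[ℂ] HilbertTensor H K),
      ∀ a b, Φ (tmul a b) = opTensor (π a) (ρ b) := by
  choose V hV v hv using exists_universal_intertwiner π
  choose W hW w hw using exists_universal_intertwiner ρ
  refine exists_transport (V := fun p : H × K => opTensorMap (V p.1) (W p.2)) ?_ (rep A B)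
    (fun a b => opTensor (π a) (ρ b)) (fun a b => ?_) fun a b p z => ?_
  · refine dense_span_hilbertTmul.mono (Submodule.span_mono ?_)
    rintro _ ⟨x, y, rfl⟩
    refine Set.mem_iUnion.mpr ⟨(x, y), hilbertTmul (v x) (w y), ?_⟩
    rw [opTensorMap_hilbertTmul, hv, hw]
  · rw [← opTensor_star, map_star, map_star]
  · rw [rep_tmul]
    induction z using hilbertTensor_induction with
    | hP => exact isClosed_eq (by fun_prop) (by fun_prop)
    | tmul x y => simp only [opTensor_hilbertTmul, opTensorMap_hilbertTmul, hV, hW]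
    | add z w hz hw => simp only [map_add, hz, hw]

/-- A homomorphism to operators which maps elementary tensors into the range of an injective
homomorphism factors through it. -/
theorem exists_lift {𝒜 : Type*} [CStarAlgebra 𝒜] (Ψ : C →⋆ₐ[ℂ] 𝒜) (hΨ : Function.Injective Ψ)
    (Φ : CStarTensor A B →⋆ₐ[ℂ] 𝒜) (h : ∀ a b, ∃ c, Ψ c = Φ (tmul a b)) :
    ∃ f : CStarTensor A B →⋆ₐ[ℂ] C, ∀ z, Ψ (f z) = Φ z := by
  have hiso : Isometry Ψ := NonUnitalStarAlgHom.isometry Ψ hΨ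
  have hmem : ∀ z, ∃ c, Ψ c = Φ z := by
    intro z
    induction z using induction_on with
    | hP =>
      exact hiso.isClosedEmbedding.isClosed_range.preimage (continuous_starAlgHom Φ)
    | tmul a b => exact h a b
    | add z w hz hw =>
      obtain ⟨c, hc⟩ := hz
      obtain ⟨d, hd⟩ := hw
      exact ⟨c + d, by rw [map_add, map_add, hc, hd]⟩
  choose f hf using hmem
  exact ⟨{
    toFun := f
    map_one' := hΨ (by rw [hf, map_one, map_one])
    map_mul' := fun a b => hΨ (by rw [hf, map_mul, map_mul, hf, hf])
    map_zero' := hΨ (by rw [hf, map_zero, map_zero])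
    map_add' := fun a b => hΨ (by rw [hf, map_add, map_add, hf, hf])
    commutes' := fun c => hΨ (by rw [hf, AlgHomClass.commutes, AlgHomClass.commutes])
    map_star' := fun a => hΨ (by rw [hf, map_star, map_star, hf]) }, hf⟩

theorem exists_map (f : A →⋆ₐ[ℂ] C) (g : B →⋆ₐ[ℂ] E) :
    ∃ h : CStarTensor A B →⋆ₐ[ℂ] CStarTensor C E, ∀ a b, h (tmul a b) = tmul (f a) (g b) := by
  obtain ⟨Φ, hΦ⟩ := exists_hom_of_reps ((universalRep C).comp f) ((universalRep E).comp g)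
  have hΦ' : ∀ a b, rep C E (tmul (f a) (g b)) = Φ (tmul a b) := fun a b => by
    rw [hΦ, rep_tmul]; rfl
  obtain ⟨h, hh⟩ := exists_lift (rep C E) rep_injective Φ fun a b => ⟨_, hΦ' a b⟩
  exact ⟨h, fun a b => rep_injective (by rw [hh, hΦ'])⟩

/-- The homomorphism `f ⊗ g`. -/
noncomputable def map (f : A →⋆ₐ[ℂ] C) (g : B →⋆ₐ[ℂ] E) :
    CStarTensor A B →⋆ₐ[ℂ] CStarTensor C E :=
  (exists_map f g).choose

theorem map_tmul (f : A →⋆ₐ[ℂ] C) (g : B →⋆ₐ[ℂ] E) (a : A) (b : B) :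
    map f g (tmul a b) = tmul (f a) (g b) :=
  (exists_map f g).choose_spec a b

theorem map_tensorOneRight (f : A →⋆ₐ[ℂ] C) (g : B →⋆ₐ[ℂ] E) (a : A) :
    map f g (tensorOneRight A B a) = tensorOneRight C E (f a) := by
  rw [← tmul_one, map_tmul, map_one, tmul_one]

theorem map_tensorOneLeft (f : A →⋆ₐ[ℂ] C) (g : B →⋆ₐ[ℂ] E) (b : B) :
    map f g (tensorOneLeft A B b) = tensorOneLeft C E (g b) := by
  rw [← one_tmul, map_tmul, map_one, one_tmul]

theorem exists_flip : ∃ h : CStarTensor A B →⋆ₐ[ℂ] CStarTensor B A,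
    ∀ a b, h (tmul a b) = tmul b a := by
  obtain ⟨Φ, hΦ⟩ := exists_transport (V := fun _ : Unit => hilbertComm _ _) (by
    refine dense_span_hilbertTmul.mono (Submodule.span_mono ?_)
    rintro _ ⟨x, y, rfl⟩
    exact Set.mem_iUnion.mpr ⟨(), hilbertTmul y x, hilbertComm_hilbertTmul y x⟩) (rep A B)
    (fun a b => rep B A (tmul b a)) (fun a b => by rw [← map_star, star_tmul]) (fun a b _ z => by
      rw [rep_tmul, rep_tmul]
      induction z using hilbertTensor_induction with
      | hP => exact isClosed_eq (by fun_prop) (by fun_prop)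
      | tmul x y => simp only [opTensor_hilbertTmul, hilbertComm_hilbertTmul]
      | add z w hz hw => simp only [map_add, hz, hw])
  obtain ⟨h, hh⟩ := exists_lift (rep B A) rep_injective Φ fun a b => ⟨_, (hΦ a b).symm⟩
  exact ⟨h, fun a b => rep_injective (by rw [hh, hΦ])⟩

/-- The flip `a ⊗ b ↦ b ⊗ a`. -/
noncomputable def flip (A B : Type*) [CStarAlgebra A] [CStarAlgebra B] :
    CStarTensor A B →⋆ₐ[ℂ] CStarTensor B A :=
  exists_flip.choose

theorem flip_tmul (a : A) (b : B) : flip A B (tmul a b) = tmul b a :=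
  exists_flip.choose_spec a b

theorem flip_tensorOneRight (a : A) : flip A B (tensorOneRight A B a) = tensorOneLeft B A a := by
  rw [← tmul_one, flip_tmul, one_tmul]

theorem flip_tensorOneLeft (b : B) : flip A B (tensorOneLeft A B b) = tensorOneRight B A b := by
  rw [← one_tmul, flip_tmul, tmul_one]

theorem tmulLeftL_adjoint_opTensor {H K : Type*} [NormedAddCommGroup H] [InnerProductSpace ℂ H]
    [CompleteSpace H] [NormedAddCommGroup K] [InnerProductSpace ℂ K] [CompleteSpace K]
    (S : H →L[ℂ] H) (T : K →L[ℂ] K) (x x' : H) :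
    (tmulLeftL x' : K →L[ℂ] HilbertTensor H K).adjoint ∘L opTensor S T ∘L tmulLeftL x =
      ⟪x', S x⟫_ℂ • T := by
  ext y
  refine ext_inner_left ℂ fun y' => ?_
  simp [ContinuousLinearMap.adjoint_inner_right, opTensor_hilbertTmul, inner_hilbertTmul,
    inner_smul_right]

/-- If `ρ` is faithful, so is the representation of `A ⊗ B` on `H_A ⊗ K` induced by `ρ`: the slice
of `z` by two vectors of `H_A` is, up to limits, given by an element of `B`, whose norm `ρ`
preserves. Hence all matrix coefficients of an element of the kernel vanish. -/
theorem injective_of_faithful {K : Type*} [NormedAddCommGroup K] [InnerProductSpace ℂ K]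
    [CompleteSpace K] (ρ : B →⋆ₐ[ℂ] (K →L[ℂ] K)) (hρ : Function.Injective ρ)
    (Φ : CStarTensor A B →⋆ₐ[ℂ]
      (HilbertTensor (UniversalSpace A) K →L[ℂ] HilbertTensor (UniversalSpace A) K))
    (hΦ : ∀ a b, Φ (tmul a b) = opTensor (universalRep A a) (ρ b)) : Function.Injective Φ := by
  let s₁ (x x' : UniversalSpace A) (z : CStarTensor A B) :=
    (tmulLeftL x' : UniversalSpace B →L[ℂ] _).adjoint ∘L rep A B z ∘L tmulLeftL x
  let s₂ (x x' : UniversalSpace A) (z : CStarTensor A B) :=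
    (tmulLeftL x' : K →L[ℂ] _).adjoint ∘L Φ z ∘L tmulLeftL x
  have hs₁ : ∀ x x', Continuous (s₁ x x') := fun x x' =>
    continuous_const.clm_comp ((continuous_starAlgHom (rep A B)).clm_comp continuous_const)
  have hs₂ : ∀ x x', Continuous (s₂ x x') := fun x x' =>
    continuous_const.clm_comp ((continuous_starAlgHom Φ).clm_comp continuous_const)
  have key : ∀ x x' z, ‖s₁ x x' z‖ ≤ ‖s₂ x x' z‖ := by
    intro x x' z
    have hdense : ∀ w ∈ algebraic A B, ∃ b, s₁ x x' w = universalRep B b ∧ s₂ x x' w = ρ b := by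
      intro w hw
      induction hw using Submodule.span_induction with
      | mem w hw =>
        obtain ⟨⟨a, b⟩, rfl⟩ := hw
        refine ⟨⟪x', universalRep A a x⟫_ℂ • b, ?_, ?_⟩
        · simp only [s₁]
          rw [rep_tmul, tmulLeftL_adjoint_opTensor, map_smul]
        · simp only [s₂]
          rw [hΦ, tmulLeftL_adjoint_opTensor, map_smul]
      | zero => exact ⟨0, by simp [s₁], by simp [s₂]⟩
      | add w w' _ _ h h' =>
        obtain ⟨b, hb₁, hb₂⟩ := h
        obtain ⟨b', hb₁', hb₂'⟩ := h'
        refine ⟨b + b', ?_, ?_⟩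
        · rw [map_add, ← hb₁, ← hb₁']; ext; simp [s₁]
        · rw [map_add, ← hb₂, ← hb₂']; ext; simp [s₂]
      | smul c w _ h =>
        obtain ⟨b, hb₁, hb₂⟩ := h
        refine ⟨c • b, ?_, ?_⟩
        · rw [map_smul, ← hb₁]; ext; simp [s₁]
        · rw [map_smul, ← hb₂]; ext; simp [s₂]
    refine dense_algebraic.induction (P := fun z => ‖s₁ x x' z‖ ≤ ‖s₂ x x' z‖) (fun w hw => ?_)
      (isClosed_le (hs₁ x x').norm (hs₂ x x').norm) z
    obtain ⟨b, hb₁, hb₂⟩ := hdense w hw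
    rw [hb₁, hb₂, NonUnitalStarAlgHom.norm_map ρ hρ]
    exact NonUnitalStarAlgHom.norm_apply_le _ b
  refine (injective_iff_map_eq_zero Φ).mpr fun z hz => rep_injective ?_
  have h0 : ∀ x x' y, (tmulLeftL x' : UniversalSpace B →L[ℂ] _).adjoint
      (rep A B z (hilbertTmul x y)) = 0 := by
    intro x x' y
    have h1 : s₁ x x' z = 0 := by
      refine norm_le_zero_iff.mp ((key x x' z).trans ?_)
      simp [s₂, hz]
    exact congrArg (fun T : UniversalSpace B →L[ℂ] UniversalSpace B => T y) h1
  rw [map_zero]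
  ext t : 1
  induction t using hilbertTensor_induction with
  | hP => exact isClosed_eq (by fun_prop) (by fun_prop)
  | add t t' h h' => rw [map_add, h, h', map_add]
  | tmul x y =>
    refine ext_inner_left ℂ fun u => ?_
    rw [zero_apply, inner_zero_right]
    induction u using hilbertTensor_induction with
    | hP => exact isClosed_eq (by fun_prop) (by fun_prop)
    | add t t' h h' => rw [inner_add_left, h, h', add_zero]
    | tmul x' y' =>
      rw [← tmulLeftL_apply x' y', ← ContinuousLinearMap.adjoint_inner_right, h0,
        inner_zero_right]

theorem dense_span_range_hilbertAssoc {H K L : Type*} [NormedAddCommGroup H]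
    [InnerProductSpace ℂ H] [NormedAddCommGroup K] [InnerProductSpace ℂ K] [NormedAddCommGroup L]
    [InnerProductSpace ℂ L] :
    Dense (Submodule.span ℂ (Set.range (hilbertAssoc H K L)) :
      Set (HilbertTensor H (HilbertTensor K L))) := by
  intro z
  change z ∈ (Submodule.span ℂ (Set.range (hilbertAssoc H K L))).topologicalClosure
  induction z using hilbertTensor_induction with
  | hP => exact Submodule.isClosed_topologicalClosure _
  | add z w hz hw => exact add_mem hz hw
  | tmul x t =>
    rw [← tmulLeftL_apply]
    induction t using hilbertTensor_induction with
    | hP => exact (Submodule.isClosed_topologicalClosure _).preimage (tmulLeftL x).continuous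
    | add z w hz hw => rw [map_add]; exact add_mem hz hw
    | tmul y l =>
      refine Submodule.le_topologicalClosure _ (Submodule.subset_span ?_)
      exact ⟨hilbertTmul (hilbertTmul x y) l, hilbertAssoc_hilbertTmul x y l⟩

variable (A B C) in
/-- The embedding of `A ⊗ B` in `A ⊗ (B ⊗ C)`. -/
noncomputable def assocLeft : CStarTensor A B →⋆ₐ[ℂ] CStarTensor A (CStarTensor B C) :=
  map (StarAlgHom.id ℂ A) (tensorOneRight B C)

theorem assocLeft_tmul (a : A) (b : B) :
    assocLeft A B C (tmul a b) = tmul a (tensorOneRight B C b) := map_tmul _ _ _ _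

theorem assocLeft_tmul_mul (a : A) (b : B) (c : C) :
    assocLeft A B C (tmul a b) * tensorOneLeft A _ (tensorOneLeft B C c) = tmul a (tmul b c) := by
  rw [assocLeft_tmul, ← one_tmul (A := A), tmul_mul_tmul, mul_one]
  rfl

theorem star_assocLeft_mul (z : CStarTensor A B) (c : C) :
    star (assocLeft A B C z * tensorOneLeft A _ (tensorOneLeft B C c)) =
      assocLeft A B C (star z) * tensorOneLeft A _ (tensorOneLeft B C (star c)) := by
  have hc := continuous_starAlgHom (assocLeft A B C)
  induction z using induction_on with
  | hP => exact isClosed_eq (by fun_prop) (by fun_prop)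
  | tmul a b => rw [star_tmul, assocLeft_tmul_mul, assocLeft_tmul_mul, star_tmul, star_tmul]
  | add z w hz hw => rw [map_add, add_mul, star_add, hz, hw, star_add, map_add, add_mul]

/-- The associator exists on the minimal tensor product: `(A ⊗ B) ⊗ C` and `A ⊗ (B ⊗ C)` are both
represented on the threefold tensor product of the universal spaces, the latter faithfully. -/
theorem exists_assoc : ∃ h : CStarTensor (CStarTensor A B) C →⋆ₐ[ℂ] CStarTensor A (CStarTensor B C),
    ∀ z c, h (tmul z c) = assocLeft A B C z * tensorOneLeft A _ (tensorOneLeft B C c) := by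
  obtain ⟨Φ, hΦ⟩ := exists_hom_of_reps (rep A B) (universalRep C)
  obtain ⟨Ψ, hΨ⟩ := exists_hom_of_reps (universalRep A) (rep B C)
  have hΨi : Function.Injective Ψ := injective_of_faithful _ rep_injective Ψ hΨ
  have hΨc := continuous_starAlgHom Ψ
  have hlc := continuous_starAlgHom (assocLeft A B C)
  have hrc := continuous_starAlgHom (rep A B)
  have hΦc := continuous_starAlgHom Φ
  let W := hilbertAssoc (UniversalSpace A) (UniversalSpace B) (UniversalSpace C)
  obtain ⟨Φ', hΦ'⟩ := exists_transport (V := fun _ : Unit => W)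
    (by rw [Set.iUnion_const]; exact dense_span_range_hilbertAssoc) Φ
    (fun z c => Ψ (assocLeft A B C z * tensorOneLeft A _ (tensorOneLeft B C c)))
    (fun z c => by rw [← map_star, star_assocLeft_mul]) (fun z c _ x => by
      induction z using induction_on with
      | hP =>
        have h1 : Continuous fun z : CStarTensor A B => Φ (tmul z c) :=
          hΦc.comp ((continuous_starAlgHom (tensorOneRight _ C)).mul continuous_const)
        have h2 : Continuous fun z : CStarTensor A B =>
            Ψ (assocLeft A B C z * tensorOneLeft A _ (tensorOneLeft B C c)) := by fun_prop
        exact isClosed_eq (W.continuous.comp (h1.clm_apply continuous_const))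
          (h2.clm_apply continuous_const)
      | add z w hz hw =>
        have h3 : tmul (z + w) c = tmul z c + tmul w c := by
          simp only [tmul, map_add, add_mul]
        rw [h3, map_add, map_add, add_mul, map_add, add_apply, map_add, hz, hw, add_apply]
      | tmul a b =>
        rw [assocLeft_tmul_mul, hΦ, hΨ, rep_tmul, rep_tmul]
        induction x using hilbertTensor_induction with
        | hP => exact isClosed_eq (by fun_prop) (by fun_prop)
        | add x x' h h' => simp only [map_add, h, h']
        | tmul t l =>
          rw [← tmulRightL_apply]
          induction t using hilbertTensor_induction with
          | hP => exact isClosed_eq (by fun_prop) (by fun_prop)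
          | add x x' h h' => simp only [map_add, h, h']
          | tmul x y =>
            simp only [W, tmulRightL_apply, opTensor_hilbertTmul, hilbertAssoc_hilbertTmul])
  obtain ⟨h, hh⟩ := exists_lift Ψ hΨi Φ' fun z c => ⟨_, (hΦ' z c).symm⟩
  exact ⟨h, fun z c => hΨi (by rw [hh, hΦ'])⟩

/-- The associator `(A ⊗ B) ⊗ C → A ⊗ (B ⊗ C)`. -/
noncomputable def assoc (A B C : Type*) [CStarAlgebra A] [CStarAlgebra B] [CStarAlgebra C] :
    CStarTensor (CStarTensor A B) C →⋆ₐ[ℂ] CStarTensor A (CStarTensor B C) :=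
  exists_assoc.choose

theorem assoc_tensorOneRight (z : CStarTensor A B) :
    assoc A B C (tensorOneRight _ C z) = assocLeft A B C z := by
  rw [← tmul_one, assoc, exists_assoc.choose_spec, map_one, map_one, mul_one]

/-- Two homomorphisms on `A ⊗ B` that are close on sufficiently many elements of `A ⊗ 1` and
`1 ⊗ B` are close on a given element. -/
theorem exists_finset_close (x : CStarTensor A B) :
    ∀ η : ℝ, 0 < η → ∃ (F : Finset A) (G : Finset B) (δ : ℝ), 0 < δ ∧
      ∀ h h' : CStarTensor A B →⋆ₐ[ℂ] E,
        (∀ a ∈ F, ‖h (tensorOneRight A B a) - h' (tensorOneRight A B a)‖ < δ) →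
        (∀ b ∈ G, ‖h (tensorOneLeft A B b) - h' (tensorOneLeft A B b)‖ < δ) →
        ‖h x - h' x‖ < η := by
  classical
  induction x using induction_on with
  | hP =>
    refine isClosed_of_closure_subset fun x hx η hη => ?_
    obtain ⟨y, hy, hxy⟩ := Metric.mem_closure_iff.mp hx (η / 4) (by positivity)
    obtain ⟨F, G, δ, hδ, hFG⟩ := hy (η / 4) (by positivity)
    refine ⟨F, G, δ, hδ, fun h h' hF hG => ?_⟩
    rw [dist_eq_norm] at hxy
    calc ‖h x - h' x‖ = ‖h (x - y) - h' (x - y) + (h y - h' y)‖ := by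
          rw [map_sub, map_sub]; congr 1; abel
      _ ≤ ‖h (x - y)‖ + ‖h' (x - y)‖ + ‖h y - h' y‖ :=
          (norm_add_le _ _).trans (by gcongr; exact norm_sub_le _ _)
      _ ≤ ‖x - y‖ + ‖x - y‖ + ‖h y - h' y‖ := by
          gcongr <;> exact NonUnitalStarAlgHom.norm_apply_le _ _
      _ < η := by linarith [hFG h h' hF hG]
  | tmul a b =>
    intro η hη
    refine ⟨{a}, {b}, η / (‖a‖ + ‖b‖ + 1), by positivity, fun h h' ha hb => ?_⟩
    specialize ha a (Finset.mem_singleton_self a)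
    specialize hb b (Finset.mem_singleton_self b)
    have e₁ : ‖h (tensorOneRight A B a)‖ ≤ ‖a‖ :=
      (NonUnitalStarAlgHom.norm_apply_le h _).trans (NonUnitalStarAlgHom.norm_apply_le _ a)
    have e₂ : ‖h' (tensorOneLeft A B b)‖ ≤ ‖b‖ :=
      (NonUnitalStarAlgHom.norm_apply_le h' _).trans (NonUnitalStarAlgHom.norm_apply_le _ b)
    set δ := η / (‖a‖ + ‖b‖ + 1) with hδ
    have hδ0 : 0 < δ := by positivity
    calc ‖h (tmul a b) - h' (tmul a b)‖
        = ‖h (tensorOneRight A B a) * (h (tensorOneLeft A B b) - h' (tensorOneLeft A B b)) +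
          (h (tensorOneRight A B a) - h' (tensorOneRight A B a)) * h' (tensorOneLeft A B b)‖ := by
          rw [tmul, map_mul, map_mul]; congr 1; noncomm_ring
      _ ≤ ‖a‖ * δ + δ * ‖b‖ := by
          refine (norm_add_le _ _).trans (add_le_add ?_ ?_)
          · exact (norm_mul_le _ _).trans (by gcongr)
          · exact (norm_mul_le _ _).trans (by gcongr)
      _ < (‖a‖ + ‖b‖ + 1) * δ := by nlinarith
      _ = η := by rw [hδ]; field_simp
  | add x y hx hy =>
    intro η hη
    obtain ⟨F, G, δ, hδ, h₁⟩ := hx (η / 2) (by positivity)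
    obtain ⟨F', G', δ', hδ', h₂⟩ := hy (η / 2) (by positivity)
    refine ⟨F ∪ F', G ∪ G', min δ δ', lt_min hδ hδ', fun h h' hF hG => ?_⟩
    have e₁ := h₁ h h'
      (fun a ha => (hF a (Finset.mem_union_left _ ha)).trans_le (min_le_left _ _))
      (fun a ha => (hG a (Finset.mem_union_left _ ha)).trans_le (min_le_left _ _))
    have e₂ := h₂ h h'
      (fun a ha => (hF a (Finset.mem_union_right _ ha)).trans_le (min_le_right _ _))
      (fun a ha => (hG a (Finset.mem_union_right _ ha)).trans_le (min_le_right _ _))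
    calc ‖h (x + y) - h' (x + y)‖ = ‖(h x - h' x) + (h y - h' y)‖ := by
          rw [map_add, map_add]; congr 1; abel
      _ < η := (norm_add_le _ _).trans_lt (by linarith)

theorem exists_finset_close_on (X : Finset (CStarTensor A B)) {η : ℝ} (hη : 0 < η) :
    ∃ (F : Finset A) (G : Finset B) (δ : ℝ), 0 < δ ∧
      ∀ h h' : CStarTensor A B →⋆ₐ[ℂ] E,
        (∀ a ∈ F, ‖h (tensorOneRight A B a) - h' (tensorOneRight A B a)‖ < δ) →
        (∀ b ∈ G, ‖h (tensorOneLeft A B b) - h' (tensorOneLeft A B b)‖ < δ) →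
        ∀ x ∈ X, ‖h x - h' x‖ < η := by
  classical
  induction X using Finset.induction_on with
  | empty => exact ⟨∅, ∅, 1, one_pos, by simp⟩
  | insert x X _ ih =>
    obtain ⟨F, G, δ, hδ, h₁⟩ := ih
    obtain ⟨F', G', δ', hδ', h₂⟩ := exists_finset_close (E := E) x η hη
    refine ⟨F ∪ F', G ∪ G', min δ δ', lt_min hδ hδ', fun h h' hF hG y hy => ?_⟩
    rcases Finset.mem_insert.mp hy with rfl | hy
    · exact h₂ h h'
        (fun a ha => (hF a (Finset.mem_union_right _ ha)).trans_le (min_le_right _ _))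
        (fun a ha => (hG a (Finset.mem_union_right _ ha)).trans_le (min_le_right _ _))
    · exact h₁ h h'
        (fun a ha => (hF a (Finset.mem_union_left _ ha)).trans_le (min_le_left _ _))
        (fun a ha => (hG a (Finset.mem_union_left _ ha)).trans_le (min_le_left _ _)) y hy

end CStarTensor

end CStarTensorMaps

/-! ### Commutators of unitaries and `K₁`-injectivity -/

section Commutators

variable {A : Type*} [CStarAlgebra A]

/-- The rotation matrix with entries `cos t`, `± sin t`. -/
noncomputable def rotationMat (A : Type*) [CStarAlgebra A] (t : ℝ) : Matrix (Fin 2) (Fin 2) A :=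
  !![algebraMap ℂ A (Real.cos t), -algebraMap ℂ A (Real.sin t);
    algebraMap ℂ A (Real.sin t), algebraMap ℂ A (Real.cos t)]

theorem star_rotationMat (t : ℝ) :
    star (rotationMat A t) = !![algebraMap ℂ A (Real.cos t), algebraMap ℂ A (Real.sin t);
      -algebraMap ℂ A (Real.sin t), algebraMap ℂ A (Real.cos t)] := by
  ext i j
  fin_cases i <;> fin_cases j <;>
    simp [rotationMat, Matrix.star_apply, ← algebraMap_star_comm, -Complex.ofReal_cos,
      -Complex.ofReal_sin]

theorem rotationMat_mem (t : ℝ) : rotationMat A t ∈ unitary (Matrix (Fin 2) (Fin 2) A) := by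
  have h : ((Real.cos t : ℂ) * Real.cos t + Real.sin t * Real.sin t) = 1 := by
    exact_mod_cast (by nlinarith [Real.cos_sq_add_sin_sq t] :
      Real.cos t * Real.cos t + Real.sin t * Real.sin t = 1)
  have h₁ : algebraMap ℂ A (Real.cos t) * algebraMap ℂ A (Real.cos t) +
      algebraMap ℂ A (Real.sin t) * algebraMap ℂ A (Real.sin t) = 1 := by
    rw [← map_mul, ← map_mul, ← map_add, h, map_one]
  have h₂ := Algebra.commutes (A := A) (Real.cos t : ℂ) (algebraMap ℂ A (Real.sin t))
  have h₃ := (add_comm _ _).trans h₁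
  rw [Unitary.mem_iff, star_rotationMat, rotationMat, Matrix.mul_fin_two, Matrix.mul_fin_two,
    Matrix.one_fin_two]
  generalize algebraMap ℂ A (Real.cos t) = c at *
  generalize algebraMap ℂ A (Real.sin t) = s at *
  constructor <;> simp [h₁, h₂, h₃]

/-- The rotation by the angle `t` as a unitary matrix. -/
noncomputable def rotationUnitary (A : Type*) [CStarAlgebra A] (t : ℝ) : UnitaryMat A 2 :=
  ⟨rotationMat A t, rotationMat_mem t⟩

theorem continuous_rotationUnitary : Continuous (rotationUnitary A) := by
  have hc : Continuous (algebraMap ℂ A) := algebraMapCLM ℂ A |>.continuous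
  refine Continuous.subtype_mk (continuous_matrix fun i j => ?_) _
  fin_cases i <;> fin_cases j <;> simp [rotationMat, -Complex.ofReal_cos, -Complex.ofReal_sin] <;>
    fun_prop

/-- The unitary `u ⊕ 1` of `M₂(A)`. -/
noncomputable def padTwo (u : unitary A) : UnitaryMat A 2 :=
  padUnitary A one_le_two (unitaryToMat A u)

theorem padTwo_val (u : unitary A) :
    (padTwo u : Matrix (Fin 2) (Fin 2) A) = !![(u : A), 0; 0, 1] := by
  ext i j
  fin_cases i <;> fin_cases j <;> simp [padTwo, padUnitary, padMat, unitaryToMat]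

theorem padTwo_mul (u v : unitary A) : padTwo (u * v) = padTwo u * padTwo v := by
  simp [padTwo]

theorem padTwo_inv (u : unitary A) : padTwo u⁻¹ = (padTwo u)⁻¹ := by
  simp [padTwo]

/-- Rotating by a quarter turn turns `v ⊕ 1` into `1 ⊕ v`, which commutes with `u ⊕ 1`. -/
theorem commute_padTwo_rotation (u v : unitary A) :
    Commute (padTwo u)
      (rotationUnitary A (Real.pi / 2) * padTwo v * (rotationUnitary A (Real.pi / 2))⁻¹) := by
  refine Subtype.ext ?_
  have h : ((rotationUnitary A (Real.pi / 2) * padTwo v * (rotationUnitary A (Real.pi / 2))⁻¹ :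
      UnitaryMat A 2) : Matrix (Fin 2) (Fin 2) A) = !![1, 0; 0, (v : A)] := by
    rw [← Unitary.star_eq_inv]
    simp only [Submonoid.coe_mul, Unitary.coe_star, padTwo_val, rotationUnitary, star_rotationMat]
    simp [rotationMat]
  generalize
    rotationUnitary A (Real.pi / 2) * padTwo v * (rotationUnitary A (Real.pi / 2))⁻¹ = w at *
  rw [Submonoid.coe_mul, Submonoid.coe_mul, h, padTwo_val]
  simp

theorem padTwo_commutator_mem (u v : unitary A) :
    padTwo (u * v * u⁻¹ * v⁻¹) ∈ Subgroup.connectedComponentOfOne (UnitaryMat A 2) := by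
  let f : ℝ → UnitaryMat A 2 := fun t =>
    padTwo u * (rotationUnitary A t * padTwo v * (rotationUnitary A t)⁻¹) * (padTwo u)⁻¹ *
      (rotationUnitary A t * padTwo v * (rotationUnitary A t)⁻¹)⁻¹
  have hf : Continuous f := by
    have := continuous_rotationUnitary (A := A)
    fun_prop
  have h0 : f 0 = padTwo (u * v * u⁻¹ * v⁻¹) := by
    have h : rotationUnitary A 0 = 1 := by
      refine Subtype.ext ?_
      simp [rotationUnitary, rotationMat, Matrix.one_fin_two]
    simp [f, h, padTwo_mul, padTwo_inv]
  have h1 : f (Real.pi / 2) = 1 := by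
    simp only [f]
    rw [(commute_padTwo_rotation u v).eq]
    group
  have hj : Joined (1 : UnitaryMat A 2) (padTwo (u * v * u⁻¹ * v⁻¹)) := by
    rw [← h0, ← h1]
    exact (PathConnectedSpace.joined (Real.pi / 2) (0 : ℝ)).map hf
  exact pathComponent_subset_component _ hj

/-- In a `K₁`-injective algebra commutators of unitaries are in the connected component of `1`. -/
theorem IsKOneInjective.joined_commutator (hK : IsKOneInjective A) (u v : unitary A) :
    Joined 1 (u * v * u⁻¹ * v⁻¹) := by
  have h : (QuotientGroup.mk (u * v * u⁻¹ * v⁻¹) : Pi0 (unitary A)) = 1 := by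
    refine hK (Quotient.sound ⟨2, one_le_two, one_le_two, ?_⟩)
    rw [map_one, map_one]
    exact (QuotientGroup.eq_one_iff _).mpr (padTwo_commutator_mem u v)
  have h' : u * v * u⁻¹ * v⁻¹ ∈ connectedComponent (1 : unitary A) :=
    (QuotientGroup.eq_one_iff _).mp h
  rwa [← pathComponent_eq_connectedComponent] at h'

end Commutators

/-! ### Approximate unitary equivalence on finite sets -/

section ApproxEquiv

variable {A B C : Type*} [CStarAlgebra A] [CStarAlgebra B] [CStarAlgebra C]

/-- The inner automorphism `b ↦ u b u*`. -/
noncomputable def conjHom (u : unitary B) : B →⋆ₐ[ℂ] B :=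
  (Unitary.conjStarAlgAut ℂ B u : B →⋆ₐ[ℂ] B)

theorem conjHom_apply (u : unitary B) (b : B) : conjHom u b = u * b * star (u : B) := rfl

theorem conjHom_mul (u v : unitary B) (b : B) : conjHom (u * v) b = conjHom u (conjHom v b) := by
  simp [conjHom_apply, mul_assoc]

theorem conjHom_star_conjHom (u : unitary B) (b : B) : conjHom (star u) (conjHom u b) = b := by
  rw [← conjHom_mul, Unitary.star_mul_self]
  simp [conjHom_apply]

theorem norm_conjHom (u : unitary B) (b : B) : ‖conjHom u b‖ = ‖b‖ := by
  simp [conjHom_apply, ← Unitary.coe_star, mul_assoc]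

theorem norm_conjHom_inv_sub_lt {u : unitary B} {b c : B} {ε : ℝ} (h : ‖conjHom u b - c‖ < ε) :
    ‖conjHom u⁻¹ c - b‖ < ε := by
  rw [← Unitary.star_eq_inv]
  calc ‖conjHom (star u) c - b‖ = ‖conjHom (star u) (c - conjHom u b)‖ := by
        rw [map_sub, conjHom_star_conjHom]
    _ < ε := by rwa [norm_conjHom, norm_sub_rev]

theorem norm_conjHom_mul_sub_lt {u v : unitary B} {a b c : B} {ε ε' : ℝ}
    (h : ‖conjHom u a - b‖ < ε) (h' : ‖conjHom v b - c‖ < ε') :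
    ‖conjHom (v * u) a - c‖ < ε + ε' := by
  have e : conjHom (v * u) a - c = conjHom v (conjHom u a - b) + (conjHom v b - c) := by
    rw [conjHom_mul, map_sub]; abel
  rw [e]
  refine (norm_add_le _ _).trans_lt ?_
  rw [norm_conjHom]
  linarith

theorem conjHom_one (b : B) : conjHom (1 : unitary B) b = b := by
  simp [conjHom_apply]

theorem conjHom_eq_self_of_commute {u : unitary B} {b : B} (h : Commute (u : B) b) :
    conjHom u b = b := by
  rw [conjHom_apply, h.eq, mul_assoc, Unitary.mul_star_self_of_mem u.2, mul_one]

/-- The image of a unitary under a homomorphism. -/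
noncomputable def mapUnitary (f : A →⋆ₐ[ℂ] B) : unitary A →* unitary B where
  toFun u := ⟨f (u : A), Unitary.map_mem f u.2⟩
  map_one' := Subtype.ext (map_one f)
  map_mul' u v := Subtype.ext (map_mul f (u : A) v)

@[simp]
theorem mapUnitary_coe (f : A →⋆ₐ[ℂ] B) (u : unitary A) : (mapUnitary f u : B) = f (u : A) := rfl

theorem continuous_mapUnitary (f : A →⋆ₐ[ℂ] B) : Continuous (mapUnitary f) :=
  ((CStarTensor.continuous_starAlgHom f).comp continuous_subtype_val).subtype_mk _

theorem map_conjHom (f : A →⋆ₐ[ℂ] B) (u : unitary A) (a : A) :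
    f (conjHom u a) = conjHom (mapUnitary f u) (f a) := by
  simp [conjHom_apply, map_star]

/-- Unitary equivalence up to `ε` on every finite set. -/
def ApproxEquivOn (σ γ : A →⋆ₐ[ℂ] B) : Prop :=
  ∀ (F : Finset A) (ε : ℝ), 0 < ε → ∃ u : unitary B, ∀ a ∈ F, ‖conjHom u (σ a) - γ a‖ < ε

namespace ApproxEquivOn

theorem symm {σ γ : A →⋆ₐ[ℂ] B} (h : ApproxEquivOn σ γ) : ApproxEquivOn γ σ := by
  intro F ε hε
  obtain ⟨u, hu⟩ := h F ε hε
  exact ⟨u⁻¹, fun a ha => norm_conjHom_inv_sub_lt (hu a ha)⟩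

theorem trans {σ γ τ : A →⋆ₐ[ℂ] B} (h : ApproxEquivOn σ γ) (h' : ApproxEquivOn γ τ) :
    ApproxEquivOn σ τ := by
  intro F ε hε
  obtain ⟨u, hu⟩ := h F (ε / 2) (by positivity)
  obtain ⟨v, hv⟩ := h' F (ε / 2) (by positivity)
  refine ⟨v * u, fun a ha => ?_⟩
  have h := norm_conjHom_mul_sub_lt (hu a ha) (hv a ha)
  rwa [add_halves] at h

theorem comp_left {σ γ : A →⋆ₐ[ℂ] B} (h : ApproxEquivOn σ γ) (f : B →⋆ₐ[ℂ] C) :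
    ApproxEquivOn (f.comp σ) (f.comp γ) := by
  intro F ε hε
  obtain ⟨u, hu⟩ := h F ε hε
  refine ⟨mapUnitary f u, fun a ha => ?_⟩
  rw [StarAlgHom.comp_apply, StarAlgHom.comp_apply, ← map_conjHom, ← map_sub]
  exact (NonUnitalStarAlgHom.norm_apply_le f _).trans_lt (hu a ha)

theorem comp_right {σ γ : B →⋆ₐ[ℂ] C} (h : ApproxEquivOn σ γ) (f : A →⋆ₐ[ℂ] B) :
    ApproxEquivOn (σ.comp f) (γ.comp f) := by
  classical
  intro F ε hε
  obtain ⟨u, hu⟩ := h (F.image f) ε hε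
  exact ⟨u, fun a ha => hu (f a) (Finset.mem_image_of_mem f ha)⟩

end ApproxEquivOn

theorem ApproxUnitarilyEquiv.approxEquivOn {σ γ : A →⋆ₐ[ℂ] B} (h : ApproxUnitarilyEquiv σ γ) :
    ApproxEquivOn σ γ := by
  intro F ε hε
  obtain ⟨u, hu⟩ := h
  have h' : ∀ᶠ n in Filter.atTop, ∀ a ∈ F, ‖conjHom (u n) (σ a) - γ a‖ < ε :=
    (Filter.eventually_all_finset F).mpr fun a _ => (hu a).eventually_lt_const hε
  obtain ⟨n, hn⟩ := h'.exists
  exact ⟨u n, hn⟩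

end ApproxEquiv

/-! ### The half flip of a strongly self-absorbing algebra -/

section HalfFlip

open CStarTensor

variable {D : Type*} [CStarAlgebra D]

theorem StarAlgEquiv.coe_symm_comp_coe {A B : Type*} [CStarAlgebra A] [CStarAlgebra B]
    (φ : A ≃⋆ₐ[ℂ] B) :
    (φ.symm : B →⋆ₐ[ℂ] A).comp (φ : A →⋆ₐ[ℂ] B) = StarAlgHom.id ℂ A := by
  ext x
  exact φ.symm_apply_apply x

/-- The two factor embeddings of a strongly self-absorbing algebra are approximately equivalent.
With `α = φ⁻¹(· ⊗ 1)`, which is approximately inner, and `β = φ⁻¹(1 ⊗ ·)`, flipping the first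
tensor factor of the second-level decomposition `D ≅ D ⊗ D ≅ (D ⊗ D) ⊗ D` gives an endomorphism
`T` with `T ∘ β = β` and `T ∘ α ∘ β = α ∘ α`, so that `β ≈ α ∘ β` implies `β ≈ α ∘ α ≈ id`. -/
theorem IsStronglySelfAbsorbing.approxEquivOn_tensorOne (hD : IsStronglySelfAbsorbing D) :
    ∃ φ : D ≃⋆ₐ[ℂ] CStarTensor D D,
      ApproxEquivOn (φ : D →⋆ₐ[ℂ] CStarTensor D D) (tensorOneRight D D) ∧
      ApproxEquivOn (tensorOneRight D D) (tensorOneLeft D D) := by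
  obtain ⟨φ, hφ⟩ := hD.exists_equiv
  refine ⟨φ, hφ.approxEquivOn, ?_⟩
  let ψ : CStarTensor D D →⋆ₐ[ℂ] D := (φ.symm : CStarTensor D D →⋆ₐ[ℂ] D)
  have hφψ : ∀ z, φ (ψ z) = z := φ.apply_symm_apply
  let α : D →⋆ₐ[ℂ] D := ψ.comp (tensorOneRight D D)
  let β : D →⋆ₐ[ℂ] D := ψ.comp (tensorOneLeft D D)
  have hα : ApproxEquivOn (StarAlgHom.id ℂ D) α := by
    have h := hφ.approxEquivOn.comp_left ψ
    rwa [StarAlgEquiv.coe_symm_comp_coe] at h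
  let τ : D →⋆ₐ[ℂ] D := ψ.comp ((flip D D).comp (φ : D →⋆ₐ[ℂ] CStarTensor D D))
  let T : D →⋆ₐ[ℂ] D :=
    ψ.comp ((map τ (StarAlgHom.id ℂ D)).comp (φ : D →⋆ₐ[ℂ] CStarTensor D D))
  have hτβ : ∀ x, τ (β x) = α x := fun x => by
    change ψ (CStarTensor.flip D D (φ (ψ (tensorOneLeft D D x)))) = _
    rw [hφψ, flip_tensorOneLeft]; rfl
  have hTα : ∀ x, T (α x) = α (τ x) := fun x => by
    change ψ (map τ _ (φ (ψ (tensorOneRight D D x)))) = _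
    rw [hφψ, map_tensorOneRight]; rfl
  have hTβ : T.comp β = β := by
    ext x
    change ψ (map τ _ (φ (ψ (tensorOneLeft D D x)))) = _
    rw [hφψ, map_tensorOneLeft]; rfl
  have hTαβ : T.comp (α.comp β) = α.comp α := by
    ext x
    change T (α (β x)) = _
    rw [hTα, hτβ]; rfl
  have h₁ : ApproxEquivOn β (α.comp β) := hα.comp_right β
  have h₂ : ApproxEquivOn β (α.comp α) := by
    have h := h₁.comp_left T
    rwa [hTβ, hTαβ] at h
  have h₃ : ApproxEquivOn α β := (hα.comp_right α).trans h₂.symm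
  have h₄ := h₃.comp_left (φ : D →⋆ₐ[ℂ] CStarTensor D D)
  have e₁ : (φ : D →⋆ₐ[ℂ] CStarTensor D D).comp α = tensorOneRight D D := by
    ext x; exact hφψ _
  have e₂ : (φ : D →⋆ₐ[ℂ] CStarTensor D D).comp β = tensorOneLeft D D := by
    ext x; exact hφψ _
  rwa [e₁, e₂] at h₄

/-- The half flip of a `K₁`-injective strongly self-absorbing algebra is approximately inner by
unitaries in the connected component of `1`. If `v` moves the third of three factors to the
first and `s` moves the first to the second, then the commutator `s v s* v*` moves the first to the
second. -/
theorem IsStronglySelfAbsorbing.exists_joined_halfFlip (hD : IsStronglySelfAbsorbing D)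
    (hK : IsKOneInjective D) (F : Finset D) {ε : ℝ} (hε : 0 < ε) :
    ∃ z : unitary (CStarTensor D D), Joined 1 z ∧
      ∀ d ∈ F, ‖conjHom z (tensorOneRight D D d) - tensorOneLeft D D d‖ < ε := by
  classical
  obtain ⟨φ, hφ, hflip⟩ := hD.approxEquivOn_tensorOne
  let ψ : CStarTensor D D →⋆ₐ[ℂ] D := (φ.symm : CStarTensor D D →⋆ₐ[ℂ] D)
  have hφψ : ∀ z, φ (ψ z) = z := φ.apply_symm_apply
  let α : D →⋆ₐ[ℂ] D := ψ.comp (tensorOneRight D D)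
  let β : D →⋆ₐ[ℂ] D := ψ.comp (tensorOneLeft D D)
  have hα : ApproxEquivOn (StarAlgHom.id ℂ D) α := by
    have h := hφ.comp_left ψ
    rwa [StarAlgEquiv.coe_symm_comp_coe] at h
  have hcomm : ∀ x y, Commute (α x) (β y) := fun x y =>
    (commute_tensorOneRight_tensorOneLeft x y).map ψ
  -- `h` puts the two tensor factors in the positions `3` and `1`, and `s` moves `1` to `2`.
  let h : CStarTensor D D →⋆ₐ[ℂ] D := ψ.comp ((flip D D).comp (map (StarAlgHom.id ℂ D) α))
  have hr : ∀ x, h (tensorOneRight D D x) = β x := fun x => by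
    change ψ (CStarTensor.flip D D (map _ _ _)) = _
    rw [map_tensorOneRight, flip_tensorOneRight]; rfl
  have hl : ∀ x, h (tensorOneLeft D D x) = α (α x) := fun x => by
    change ψ (CStarTensor.flip D D (map _ _ _)) = _
    rw [map_tensorOneLeft, flip_tensorOneLeft]; rfl
  obtain ⟨u, hu⟩ := hflip F (ε / 6) (by positivity)
  let v : unitary D := mapUnitary h u
  let s : unitary D := mapUnitary (α.comp ψ) u
  have hv : ∀ d ∈ F, ‖conjHom v (β d) - α (α d)‖ < ε / 6 := fun d hd => by
    rw [← hr, ← hl, ← map_conjHom, ← map_sub]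
    exact (NonUnitalStarAlgHom.norm_apply_le h _).trans_lt (hu d hd)
  have hs : ∀ d ∈ F, ‖conjHom s (α (α d)) - α (β d)‖ < ε / 6 := fun d hd => by
    change ‖conjHom s ((α.comp ψ) (tensorOneRight D D d)) -
      (α.comp ψ) (tensorOneLeft D D d)‖ < ε / 6
    rw [← map_conjHom, ← map_sub]
    exact (NonUnitalStarAlgHom.norm_apply_le _ _).trans_lt (hu d hd)
  have hsβ : ∀ d, ‖conjHom s⁻¹ (β d) - β d‖ < ε / 6 := fun d => by
    refine norm_conjHom_inv_sub_lt ?_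
    rw [conjHom_eq_self_of_commute (hcomm _ d), sub_self, norm_zero]
    positivity
  obtain ⟨w, hw⟩ := hα (F.image α ∪ F.image β) (ε / 6) (by positivity)
  have hmain : ∀ d ∈ F, ‖conjHom (w⁻¹ * (s * v * s⁻¹ * v⁻¹) * w) (α d) - β d‖ < ε := by
    intro d hd
    have h₁ : ‖conjHom w (α d) - α (α d)‖ < ε / 6 :=
      hw _ (Finset.mem_union_left _ (Finset.mem_image_of_mem _ hd))
    have h₂ : ‖conjHom w (β d) - α (β d)‖ < ε / 6 :=
      hw _ (Finset.mem_union_right _ (Finset.mem_image_of_mem _ hd))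
    have h₃ := norm_conjHom_mul_sub_lt (norm_conjHom_mul_sub_lt (norm_conjHom_mul_sub_lt
      (norm_conjHom_mul_sub_lt (norm_conjHom_mul_sub_lt h₁ (norm_conjHom_inv_sub_lt (hv d hd)))
        (hsβ d)) (hv d hd)) (hs d hd)) (norm_conjHom_inv_sub_lt h₂)
    have e : w⁻¹ * (s * (v * (s⁻¹ * (v⁻¹ * w)))) = w⁻¹ * (s * v * s⁻¹ * v⁻¹) * w := by group
    rw [e] at h₃
    linarith
  refine ⟨mapUnitary (φ : D →⋆ₐ[ℂ] CStarTensor D D) (w⁻¹ * (s * v * s⁻¹ * v⁻¹) * w), ?_,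
    fun d hd => ?_⟩
  · have h₁ : Joined (w⁻¹ * 1 * w) (w⁻¹ * (s * v * s⁻¹ * v⁻¹) * w) :=
      ((Joined.refl w⁻¹).mul (hK.joined_commutator s v)).mul (Joined.refl w)
    rw [mul_one, inv_mul_cancel] at h₁
    have h₂ := h₁.map (continuous_mapUnitary (φ : D →⋆ₐ[ℂ] CStarTensor D D))
    rwa [map_one] at h₂
  · have h₁ := NonUnitalStarAlgHom.norm_apply_le (φ : D →⋆ₐ[ℂ] CStarTensor D D)
      (conjHom (w⁻¹ * (s * v * s⁻¹ * v⁻¹) * w) (α d) - β d)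
    rw [map_sub, map_conjHom] at h₁
    have e₁ : (φ : D →⋆ₐ[ℂ] CStarTensor D D) (α d) = tensorOneRight D D d := hφψ _
    have e₂ : (φ : D →⋆ₐ[ℂ] CStarTensor D D) (β d) = tensorOneLeft D D d := hφψ _
    rw [e₁, e₂] at h₁
    exact h₁.trans_lt (hmain d hd)

end HalfFlip

/-! ### Algebras absorbing `D` approximately -/

section Absorption

open CStarTensor

/-- `B` absorbs `D` approximately: there are homomorphisms `B ⊗ D → B` which restrict to
approximately the identity on `B ⊗ 1`. -/
def ApproxAbsorbs (B D : Type*) [CStarAlgebra B] [CStarAlgebra D] : Prop :=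
  ∀ (F : Finset B) (ε : ℝ), 0 < ε → ∃ μ : CStarTensor B D →⋆ₐ[ℂ] B,
    ∀ b ∈ F, ‖μ (tensorOneRight B D b) - b‖ < ε

variable {A B D : Type*} [CStarAlgebra A] [CStarAlgebra B] [CStarAlgebra D]

theorem IsStronglySelfAbsorbing.approxAbsorbs_self (hD : IsStronglySelfAbsorbing D) :
    ApproxAbsorbs D D := by
  intro F ε hε
  obtain ⟨φ, hφ⟩ := hD.exists_equiv
  obtain ⟨u, hu⟩ := hφ.approxEquivOn F ε hε
  refine ⟨(φ.symm : CStarTensor D D →⋆ₐ[ℂ] D).comp (conjHom u⁻¹), fun b hb => ?_⟩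
  have e : b = (φ.symm : CStarTensor D D →⋆ₐ[ℂ] D) ((φ : D →⋆ₐ[ℂ] CStarTensor D D) b) :=
    (φ.symm_apply_apply b).symm
  nth_rw 2 [e]
  rw [StarAlgHom.comp_apply, ← map_sub]
  exact (NonUnitalStarAlgHom.norm_apply_le _ _).trans_lt (norm_conjHom_inv_sub_lt (hu b hb))

theorem ApproxAbsorbs.tensor (hD : ApproxAbsorbs D D) : ApproxAbsorbs (CStarTensor A D) D := by
  intro F ε hε
  obtain ⟨_, G, δ, hδ, hG⟩ := exists_finset_close_on (E := CStarTensor A D) F hε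
  obtain ⟨μ, hμ⟩ := hD G δ hδ
  refine ⟨(map (StarAlgHom.id ℂ A) μ).comp (assoc A D D), fun b hb => ?_⟩
  rw [StarAlgHom.comp_apply, assoc_tensorOneRight]
  refine hG ((map (StarAlgHom.id ℂ A) μ).comp (assocLeft A D D)) (StarAlgHom.id ℂ _)
    (fun a _ => ?_) (fun d hd => ?_) b hb
  · rw [StarAlgHom.comp_apply, assocLeft, map_tensorOneRight, map_tensorOneRight]
    simpa using hδ
  · rw [StarAlgHom.comp_apply, assocLeft, map_tensorOneLeft, map_tensorOneLeft]
    change ‖_ - tensorOneLeft A D d‖ < δ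
    rw [← map_sub]
    exact (NonUnitalStarAlgHom.norm_apply_le _ _).trans_lt (hμ d hd)

/-- The homomorphism `D ⊗ D → B` which is approximately `σ` on the first factor. -/
noncomputable def absorbHom (μ : CStarTensor B D →⋆ₐ[ℂ] B) (σ : D →⋆ₐ[ℂ] B) :
    CStarTensor D D →⋆ₐ[ℂ] B :=
  μ.comp (map σ (StarAlgHom.id ℂ D))

theorem absorbHom_tensorOneRight (μ : CStarTensor B D →⋆ₐ[ℂ] B) (σ : D →⋆ₐ[ℂ] B) (d : D) :
    absorbHom μ σ (tensorOneRight D D d) = μ (tensorOneRight B D (σ d)) := by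
  rw [absorbHom, StarAlgHom.comp_apply, map_tensorOneRight]

theorem absorbHom_tensorOneLeft (μ : CStarTensor B D →⋆ₐ[ℂ] B) (σ : D →⋆ₐ[ℂ] B) (d : D) :
    absorbHom μ σ (tensorOneLeft D D d) = μ (tensorOneLeft B D d) := by
  rw [absorbHom, StarAlgHom.comp_apply, map_tensorOneLeft]
  rfl

theorem norm_conjHom_mapUnitary_absorbHom {μ : CStarTensor B D →⋆ₐ[ℂ] B} {σ : D →⋆ₐ[ℂ] B} {d : D}
    {z : unitary (CStarTensor D D)} {ε ε' : ℝ}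
    (hμ : ‖μ (tensorOneRight B D (σ d)) - σ d‖ < ε)
    (hz : ‖conjHom z (tensorOneRight D D d) - tensorOneLeft D D d‖ < ε') :
    ‖conjHom (mapUnitary (absorbHom μ σ) z) (σ d) - μ (tensorOneLeft B D d)‖ < ε + ε' := by
  have h₁ : ‖conjHom 1 (σ d) - μ (tensorOneRight B D (σ d))‖ < ε := by
    rwa [conjHom_one, norm_sub_rev]
  have h₂ : ‖conjHom (mapUnitary (absorbHom μ σ) z) (μ (tensorOneRight B D (σ d))) -
      μ (tensorOneLeft B D d)‖ < ε' := by
    rw [← absorbHom_tensorOneRight, ← absorbHom_tensorOneLeft μ σ, ← map_conjHom, ← map_sub]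
    exact (NonUnitalStarAlgHom.norm_apply_le _ _).trans_lt hz
  simpa using norm_conjHom_mul_sub_lt h₁ h₂

/-- The half flip of `D` is approximately inner by unitaries in the connected component of `1`. -/
def HasJoinedHalfFlip (D : Type*) [CStarAlgebra D] : Prop :=
  ∀ (F : Finset D) (ε : ℝ), 0 < ε → ∃ z : unitary (CStarTensor D D), Joined 1 z ∧
    ∀ d ∈ F, ‖conjHom z (tensorOneRight D D d) - tensorOneLeft D D d‖ < ε

/-- Homomorphisms from `D` to `B` are approximately equivalent through the connected component of
`1`: both can be flipped to the same central copy of `D`. -/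
theorem exists_joined_conj_close (hD : HasJoinedHalfFlip D) (hB : ApproxAbsorbs B D)
    (σ γ : D →⋆ₐ[ℂ] B) (F : Finset D) {ε : ℝ} (hε : 0 < ε) :
    ∃ v : unitary B, Joined 1 v ∧ ∀ d ∈ F, ‖conjHom v (σ d) - γ d‖ < ε := by
  classical
  obtain ⟨z, hz₁, hz⟩ := hD F (ε / 4) (by positivity)
  obtain ⟨μ, hμ⟩ := hB (F.image σ ∪ F.image γ) (ε / 4) (by positivity)
  refine ⟨(mapUnitary (absorbHom μ γ) z)⁻¹ * mapUnitary (absorbHom μ σ) z, ?_, fun d hd => ?_⟩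
  · simpa using (hz₁.map (continuous_mapUnitary (absorbHom μ γ))).inv.mul
      (hz₁.map (continuous_mapUnitary (absorbHom μ σ)))
  · have h₁ := norm_conjHom_mapUnitary_absorbHom
      (hμ _ (Finset.mem_union_left _ (Finset.mem_image_of_mem σ hd))) (hz d hd)
    have h₂ := norm_conjHom_mapUnitary_absorbHom
      (hμ _ (Finset.mem_union_right _ (Finset.mem_image_of_mem γ hd))) (hz d hd)
    have h₃ := norm_conjHom_mul_sub_lt h₁ (norm_conjHom_inv_sub_lt h₂)
    linarith

theorem norm_conjHom_sub_le (u w : unitary B) (b : B) :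
    ‖conjHom w b - conjHom u b‖ ≤ 2 * ‖(w : B) - u‖ * ‖b‖ := by
  have e : conjHom w b - conjHom u b =
      ((w : B) - u) * b * star (w : B) + u * b * star ((w : B) - u) := by
    rw [conjHom_apply, conjHom_apply, star_sub]; noncomm_ring
  rw [e]
  calc _ ≤ ‖((w : B) - u) * b * star (w : B)‖ + ‖u * b * star ((w : B) - u)‖ := norm_add_le _ _
    _ ≤ ‖(w : B) - u‖ * ‖b‖ + ‖b‖ * ‖(w : B) - u‖ := by
        refine add_le_add ?_ ?_
        · rw [← Unitary.coe_star, CStarRing.norm_mul_coe_unitary]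
          exact norm_mul_le _ _
        · rw [mul_assoc, CStarRing.norm_coe_unitary_mul, ← norm_star ((w : B) - u)]
          exact norm_mul_le _ _
    _ = _ := by ring

/-- The basic homotopy lemma: a unitary in the connected component of `1` that almost commutes
with `σ(D)` is joined to `1` by unitaries that almost commute with `σ(D)`. A path in `B ⊗ 1`
commutes with the second factor of `B ⊗ D`; flipping `σ(D)` to that factor and back yields the path
up to an error at its endpoint `u`, as `u` almost commutes with the flip. -/
theorem exists_joinedIn_almost_commuting (hD : HasJoinedHalfFlip D) (hB : ApproxAbsorbs B D)
    (σ : D →⋆ₐ[ℂ] B) (F : Finset D) {ε : ℝ} (hε : 0 < ε) :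
    ∃ (G : Finset D) (δ : ℝ), 0 < δ ∧ ∀ u : unitary B, Joined 1 u →
      (∀ g ∈ G, ‖conjHom u (σ g) - σ g‖ < δ) →
      JoinedIn {w : unitary B | ∀ d ∈ F, ‖conjHom w (σ d) - σ d‖ < ε} 1 u := by
  classical
  obtain ⟨z, -, hz⟩ := hD F (ε / 8) (by positivity)
  let M : ℝ := ∑ d ∈ F, ‖σ d‖
  have hM0 : 0 ≤ M := Finset.sum_nonneg fun d _ => norm_nonneg _
  have hM : ∀ d ∈ F, ‖σ d‖ ≤ M := fun d hd =>
    Finset.single_le_sum (f := fun d => ‖σ d‖) (fun d _ => norm_nonneg _) hd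
  let ρ : ℝ := min 1 (ε / (4 * (M + 1)))
  have hρ : 0 < ρ := lt_min one_pos (by positivity)
  have hρM : 2 * ρ * M ≤ ε / 2 := by
    have h : ρ ≤ ε / (4 * (M + 1)) := min_le_right _ _
    calc 2 * ρ * M ≤ 2 * (ε / (4 * (M + 1))) * (M + 1) := by gcongr; linarith
      _ = ε / 2 := by field_simp; ring
  obtain ⟨G, G', δ, hδ, hG⟩ := exists_finset_close (E := B) (z : CStarTensor D D) (ρ / 2)
    (by positivity)
  refine ⟨G ∪ F, min δ (ε / 2), lt_min hδ (by positivity), fun u hu hcomm => ?_⟩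
  obtain ⟨μ, hμ⟩ := hB (insert (u : B) (F.image σ)) (min (ε / 8) (ρ / 2))
    (lt_min (by positivity) (by positivity))
  let κ : B →⋆ₐ[ℂ] B := μ.comp (tensorOneRight B D)
  let Y : unitary B := mapUnitary (absorbHom μ σ) z
  have hY : ∀ d ∈ F, ‖conjHom Y (σ d) - μ (tensorOneLeft B D d)‖ < ε / 8 + ε / 8 := fun d hd =>
    norm_conjHom_mapUnitary_absorbHom ((hμ _ (Finset.mem_insert_of_mem
      (Finset.mem_image_of_mem σ hd))).trans_le (min_le_left _ _)) (hz d hd)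
  have hκ : ∀ w d, conjHom (mapUnitary κ w) (μ (tensorOneLeft B D d)) =
      μ (tensorOneLeft B D d) := fun w d =>
    conjHom_eq_self_of_commute ((commute_tensorOneRight_tensorOneLeft (w : B) d).map μ)
  -- The flipped path commutes with `σ(F)` up to `ε / 2`.
  have hpath : JoinedIn {w : unitary B | ∀ d ∈ F, ‖conjHom w (σ d) - σ d‖ < ε} 1
      (Y⁻¹ * mapUnitary κ u * Y) := by
    have hj : Continuous fun w : unitary B => Y⁻¹ * mapUnitary κ w * Y := by
      have := continuous_mapUnitary κ
      fun_prop
    obtain ⟨p⟩ := hu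
    refine ⟨(p.map hj).cast (by simp) rfl, fun t d hd => ?_⟩
    have h₁ : ‖conjHom (mapUnitary κ (p t)) (μ (tensorOneLeft B D d)) -
        μ (tensorOneLeft B D d)‖ < ε / 8 := by
      rw [hκ, sub_self, norm_zero]
      positivity
    have h₂ := norm_conjHom_mul_sub_lt (norm_conjHom_mul_sub_lt (hY d hd) h₁)
      (norm_conjHom_inv_sub_lt (hY d hd))
    rw [← mul_assoc] at h₂
    exact h₂.trans (by linarith)
  -- Its endpoint is close to `u`, since `u` almost commutes with `Y`.
  have hend : ‖((Y⁻¹ * mapUnitary κ u * Y : unitary B) : B) - u‖ < ρ := by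
    have h₁ : ‖conjHom (mapUnitary κ u) (Y : B) - Y‖ < ρ / 2 := by
      refine hG ((conjHom (mapUnitary κ u)).comp (absorbHom μ σ)) (absorbHom μ σ)
        (fun g hg => ?_) (fun d _ => ?_)
      · rw [StarAlgHom.comp_apply, absorbHom_tensorOneRight]
        change ‖conjHom (mapUnitary κ u) (κ (σ g)) - κ (σ g)‖ < δ
        rw [← map_conjHom, ← map_sub]
        exact (NonUnitalStarAlgHom.norm_apply_le _ _).trans_lt
          ((hcomm g (Finset.mem_union_left _ hg)).trans_le (min_le_left _ _))
      · rw [StarAlgHom.comp_apply, absorbHom_tensorOneLeft, hκ, sub_self, norm_zero]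
        exact hδ
    have h₂ : ‖(mapUnitary κ u : B) - u‖ < ρ / 2 :=
      (hμ _ (Finset.mem_insert_self _ _)).trans_le (min_le_right _ _)
    have h₃ : ‖((Y⁻¹ * mapUnitary κ u * Y : unitary B) : B) - mapUnitary κ u‖ =
        ‖conjHom (mapUnitary κ u) (Y : B) - Y‖ := by
      have e₁ : (Y : B) * ((Y⁻¹ * mapUnitary κ u * Y : unitary B) : B) = mapUnitary κ u * Y := by
        rw [← Submonoid.coe_mul, ← Submonoid.coe_mul, mul_assoc Y⁻¹, mul_inv_cancel_left]
      have e₂ : conjHom (mapUnitary κ u) (Y : B) * mapUnitary κ u = mapUnitary κ u * Y := by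
        rw [conjHom_apply, mul_assoc, Unitary.star_mul_self_of_mem (mapUnitary κ u).2, mul_one]
      rw [← CStarRing.norm_coe_unitary_mul Y, mul_sub, e₁, ← e₂, ← sub_mul,
        CStarRing.norm_mul_coe_unitary]
    calc _ ≤ ‖((Y⁻¹ * mapUnitary κ u * Y : unitary B) : B) - mapUnitary κ u‖ +
          ‖(mapUnitary κ u : B) - u‖ := norm_sub_le_norm_sub_add_norm_sub _ _ _
      _ < ρ := by rw [h₃]; linarith
  -- Near `u` all unitaries almost commute with `σ(F)`, and they are joined to `u` nearby.
  have hball := (Unitary.isPathConnected_ball u ρ hρ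
    ((min_le_left _ _).trans_lt one_lt_two)).joinedIn (Y⁻¹ * mapUnitary κ u * Y)
    (by rwa [Metric.mem_ball, Subtype.dist_eq, dist_eq_norm]) u (Metric.mem_ball_self hρ)
  refine hpath.trans (hball.mono fun w hw d hd => ?_)
  rw [Metric.mem_ball, Subtype.dist_eq, dist_eq_norm] at hw
  have h₁ := norm_conjHom_sub_le u w (σ d)
  have h₂ := (hcomm d (Finset.mem_union_right _ hd)).trans_le (min_le_right _ _)
  calc ‖conjHom w (σ d) - σ d‖
      ≤ ‖conjHom w (σ d) - conjHom u (σ d)‖ + ‖conjHom u (σ d) - σ d‖ :=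
        norm_sub_le_norm_sub_add_norm_sub _ _ _
    _ < 2 * ρ * M + ε / 2 := by
        refine add_lt_add_of_le_of_lt (h₁.trans ?_) h₂
        gcongr
        exact hM d hd
    _ ≤ ε := by linarith

end Absorption

/-! ### Concatenation of infinitely many paths -/

section Concatenation

variable {G : Type*} [Group G] [TopologicalSpace G]

/-- The partial products of a sequence of paths based at `1`, the `n`-th one run during the time
interval `[n, n + 1]`. -/
noncomputable def pathProd {r : ℕ → G} (p : ∀ n, Path 1 (r n)) : ℕ → NNReal → G
  | 0, _ => 1
  | n + 1, t => pathProd p n t * (p n).extend ((t : ℝ) - n)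

theorem continuous_pathProd [ContinuousMul G] {r : ℕ → G} (p : ∀ n, Path 1 (r n)) (n : ℕ) :
    Continuous (pathProd p n) := by
  induction n with
  | zero => exact continuous_const
  | succ n ih => exact ih.mul ((p n).continuous_extend.comp (by fun_prop))

theorem pathProd_of_le {r : ℕ → G} (p : ∀ n, Path 1 (r n)) {m n : ℕ} (hmn : m ≤ n) {t : NNReal}
    (ht : t ≤ m) : pathProd p n t = pathProd p m t := by
  induction n, hmn using Nat.le_induction with
  | base => rfl
  | succ n hn ih =>
    have h : (t : ℝ) ≤ n := by exact_mod_cast ht.trans (by exact_mod_cast hn)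
    rw [pathProd, ih, Path.extend_of_le_zero _ (by linarith), mul_one]

/-- Paths from `1` to `v 0` and from `1` to `(v n)⁻¹ * v (n + 1)` for all `n` can be joined to a
continuous family on `[0, ∞)` passing through `v n` at time `n + 1`. -/
theorem exists_continuous_concatenation [ContinuousMul G] (v : ℕ → G) (p : Path 1 (v 0))
    (q : ∀ n, Path 1 ((v n)⁻¹ * v (n + 1))) :
    ∃ w : NNReal → G, Continuous w ∧ w 0 = 1 ∧
      ∀ (n : ℕ) (t : NNReal), n + 1 ≤ t → t ≤ n + 2 → ∃ s, w t = v n * q n s := by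
  let r : ℕ → G := fun n => n.casesOn (v 0) fun n => (v n)⁻¹ * v (n + 1)
  let P : ∀ n, Path 1 (r n) := fun n => match n with
    | 0 => p
    | n + 1 => q n
  have hv : ∀ (n : ℕ) (t : NNReal), n + 1 ≤ t → pathProd P (n + 1) t = v n := by
    intro n
    induction n with
    | zero =>
      intro t ht
      have h : (1 : ℝ) ≤ t := by exact_mod_cast (by simpa using ht : (1 : NNReal) ≤ t)
      rw [pathProd, Path.extend_of_one_le _ (by simpa using h)]
      exact one_mul _
    | succ n ih =>
      intro t ht
      have h : ((n : ℝ) + 1) + 1 ≤ t := by exact_mod_cast ht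
      rw [pathProd, ih t ((le_add_of_nonneg_right zero_le_one).trans (by exact_mod_cast ht)),
        Path.extend_of_one_le _ (by push_cast; linarith)]
      exact mul_inv_cancel_left _ _
  have hfl : ∀ (t : NNReal) (N : ℕ), t ≤ N → pathProd P (⌊t⌋₊ + 1) t = pathProd P N t := by
    intro t N hN
    rcases le_total N (⌊t⌋₊ + 1) with h | h
    · exact pathProd_of_le P h hN
    · exact (pathProd_of_le P h (by exact_mod_cast (Nat.lt_floor_add_one t).le)).symm
  refine ⟨fun t => pathProd P (⌊t⌋₊ + 1) t, ?_, ?_, fun n t h₁ h₂ => ?_⟩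
  · refine continuous_iff_continuousAt.mpr fun t₀ => ?_
    refine (continuous_pathProd P (⌊t₀⌋₊ + 1)).continuousAt.congr ?_
    filter_upwards [Iio_mem_nhds (Nat.lt_floor_add_one t₀)] with t ht
    exact (hfl t _ (by exact_mod_cast (Set.mem_Iio.mp ht).le)).symm
  · change pathProd P _ 0 = 1
    rw [hfl 0 0 (by simp)]
    rfl
  · have h₃ : (n : ℝ) + 1 ≤ t := by exact_mod_cast h₁
    have h₄ : (t : ℝ) ≤ n + 2 := by exact_mod_cast h₂
    refine ⟨⟨(t : ℝ) - (n + 1), by linarith, by linarith⟩, ?_⟩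
    change pathProd P _ t = _
    rw [hfl t (n + 2) (by exact_mod_cast h₂), pathProd, hv n t h₁]
    congr 1
    rw [Path.extend_apply _ (by push_cast; constructor <;> linarith)]
    congr 1
    ext
    push_cast
    rfl

end Concatenation

/-! ### Strong asymptotic unitary equivalence -/

section Asymptotic

variable {B D : Type*} [CStarAlgebra B] [CStarAlgebra D]

/-- Choose unitaries `v n` in the connected component of `1` which conjugate `σ` to `γ` with growing
precision. Consecutive ones differ by unitaries that almost commute with `σ(D)`, so the basic
homotopy lemma provides paths between them that can be concatenated. -/
theorem stronglyAsympUnitarilyEquiv_of_approxAbsorbs [TopologicalSpace.SeparableSpace D]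
    (hD : HasJoinedHalfFlip D) (hB : ApproxAbsorbs B D) (σ γ : D →⋆ₐ[ℂ] B) :
    StronglyAsympUnitarilyEquiv σ γ := by
  classical
  let x : ℕ → D := TopologicalSpace.denseSeq D
  have hx : DenseRange x := TopologicalSpace.denseRange_denseSeq D
  let F : ℕ → Finset D := fun n => (Finset.range (n + 1)).image x
  have hF : ∀ {k n : ℕ}, k ≤ n → x k ∈ F n := fun h =>
    Finset.mem_image_of_mem x (Finset.mem_range.mpr (by omega))
  choose G δ hδ hG using fun n : ℕ =>
    exists_joinedIn_almost_commuting hD hB σ (F n) (ε := 1 / ((n : ℝ) + 1)) (by positivity)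
  -- `v n` has to be precise enough for both `(v (n - 1))⁻¹ * v n` and `(v n)⁻¹ * v (n + 1)`.
  choose v hv₁ hv using fun n : ℕ =>
    exists_joined_conj_close hD hB σ γ (F n ∪ G n ∪ G (n - 1))
      (ε := min (1 / ((n : ℝ) + 1)) (min (δ n / 2) (δ (n - 1) / 2)))
      (lt_min (by positivity) (lt_min (half_pos (hδ _)) (half_pos (hδ _))))
  have hjoin : ∀ n, JoinedIn
      {w : unitary B | ∀ d ∈ F n, ‖conjHom w (σ d) - σ d‖ < 1 / ((n : ℝ) + 1)}
      1 ((v n)⁻¹ * v (n + 1)) := by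
    intro n
    refine hG n _ (by simpa using (hv₁ n).inv.mul (hv₁ (n + 1))) fun g hg => ?_
    have h₁ := (hv n g (by simp [hg])).trans_le ((min_le_right _ _).trans (min_le_left _ _))
    have h₂ := (hv (n + 1) g (by simp [hg])).trans_le ((min_le_right _ _).trans (min_le_right _ _))
    rw [Nat.add_sub_cancel] at h₂
    have h₃ := norm_conjHom_mul_sub_lt h₂ (norm_conjHom_inv_sub_lt h₁)
    rwa [add_halves] at h₃
  choose q hq using hjoin
  obtain ⟨p⟩ := hv₁ 0
  obtain ⟨w, hw, hw0, hwn⟩ := exists_continuous_concatenation v p q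
  have hclose : ∀ (k n : ℕ) (t : NNReal), k ≤ n → n + 1 ≤ t → t ≤ n + 2 →
      ‖conjHom (w t) (σ (x k)) - γ (x k)‖ < 2 * (1 / ((n : ℝ) + 1)) := by
    intro k n t hk h₁ h₂
    obtain ⟨s, hs⟩ := hwn n t h₁ h₂
    have h₃ := (hv n (x k) (by simp [hF hk])).trans_le (min_le_left _ _)
    have h₄ := norm_conjHom_mul_sub_lt (hq n s (x k) (hF hk)) h₃
    rw [hs]
    linarith
  refine ⟨w, hw, hw0, fun a => ?_⟩
  refine Metric.tendsto_atTop.mpr fun ε hε => ?_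
  obtain ⟨k, hk⟩ := Metric.denseRange_iff.mp hx a (ε / 4) (by positivity)
  rw [dist_eq_norm] at hk
  obtain ⟨m, hm⟩ := exists_nat_one_div_lt (show 0 < ε / 4 by positivity)
  refine ⟨((max k m + 1 : ℕ) : NNReal), fun t ht => ?_⟩
  obtain ⟨n, hn⟩ : ∃ n, ⌊t⌋₊ = n + 1 :=
    ⟨⌊t⌋₊ - 1, by have := Nat.le_floor ht; omega⟩
  have hmn : max k m + 1 ≤ n + 1 := hn ▸ Nat.le_floor ht
  have h₁ : (n : NNReal) + 1 ≤ t := by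
    have := Nat.floor_le (zero_le (a := t))
    rw [hn] at this
    exact_mod_cast this
  have h₂ : t ≤ (n : NNReal) + 2 := by
    have := (Nat.lt_floor_add_one t).le
    rw [hn] at this
    push_cast at this
    linarith
  have h₃ := hclose k n t ((le_max_left k m).trans (by omega)) h₁ h₂
  have h₄ : 1 / ((n : ℝ) + 1) ≤ 1 / ((m : ℝ) + 1) :=
    Nat.one_div_le_one_div ((le_max_right k m).trans (by omega))
  rw [Real.dist_eq, sub_zero, abs_norm]
  have e : (w t : B) * σ a * star (w t : B) - γ a =
      conjHom (w t) (σ (a - x k)) + (conjHom (w t) (σ (x k)) - γ (x k)) - γ (a - x k) := by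
    rw [← conjHom_apply, map_sub, map_sub, map_sub]; abel
  rw [e]
  have h₅ : ‖conjHom (w t) (σ (a - x k))‖ ≤ ‖a - x k‖ := by
    rw [norm_conjHom]; exact NonUnitalStarAlgHom.norm_apply_le σ _
  have h₆ : ‖γ (a - x k)‖ ≤ ‖a - x k‖ := NonUnitalStarAlgHom.norm_apply_le γ _
  refine (norm_sub_le _ _).trans_lt ?_
  have h₇ := norm_add_le (conjHom (w t) (σ (a - x k))) (conjHom (w t) (σ (x k)) - γ (x k))
  linarith

end Asymptotic

theorem theorem1p2 {A : Type*} {D : Type*} [CStarAlgebra A] [CStarAlgebra D]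
    (hD : IsStronglySelfAbsorbing D) (hK : IsKOneInjective D) :
    (∀ σ γ : D →⋆ₐ[ℂ] CStarTensor A D, StronglyAsympUnitarilyEquiv σ γ) ∧
      ∀ σ γ : D →⋆ₐ[ℂ] D, StronglyAsympUnitarilyEquiv σ γ := by
  have := hD.separable
  have hflip : HasJoinedHalfFlip D := fun F ε hε => hD.exists_joined_halfFlip hK F hε
  exact ⟨stronglyAsympUnitarilyEquiv_of_approxAbsorbs hflip hD.approxAbsorbs_self.tensor,
    stronglyAsympUnitarilyEquiv_of_approxAbsorbs hflip hD.approxAbsorbs_self⟩
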